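/- **Setting.** Let $T>0$, $g\in\mathbb R$. Let $\mathcal D\subset\mathbb R^2$ be a bounded, open, connected set which for every $t\in[0,T)$ is the disjoint union $\mathcal D=\Omega^+(t)\cup\Gamma(t)\cup\Omega^-(t)$, where $\Omega^\pm(t)$ are open (with $\Omega^\pm=\Omega^\pm(0)$ connected and $\Gamma=\Gamma(0)=\overline{\Omega^+}\cap\overline{\Omega^-}$), and $\Gamma(t)$ is a closed, non-self-intersecting curve of class $W^{4,\infty}$ such that $\Omega^+(t)$ and $\Omega^-(t)$ both lie locally on one side of $\Gamma(t)$. Let $\mathcal N$ be the unit normal to $\Gamma(t)$ pointing into $\Omega^-(t)$, $\mathcal T$ the unit tangent with $\mathcal N=\mathcal T^\perp$, $(x_1,x_2)^\perp=(-x_2,x_1)$, $\nabla_{\mathcal T}$ the tangential (arclength) derivative along $\Gamma(t)$, and $H$ the curvature of $\Gamma(t)$, $\nabla_{\mathcal T}\mathcal N=H\mathcal T$. Let $(u^\pm,p^\pm)$ be a classical solution on $[0,T)$ of the irrotational incompressible two-fluid Euler equations with unit densities and unit surface tension, $$u^\pm_t+u^\pm\cdot Du^\pm+Dp^\pm=-g\,\mathrm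 e_2,\qquad \operatorname{curl}u^\pm=0,\quad \operatorname{div}u^\pm=0\qquad\text{in }\Omega^\pm(t),$$ $$p^+-p^-=H,\qquad (u^+-u^-)\cdot\mathcal N=0\quad\text{on }\Gamma(t),\qquad u^-\cdot N=0\quad\text{on }\partial\mathcal D,$$ with $\Gamma(t)$ moving with normal speed $u^+\cdot\mathcal N$; here $N$ is the outward unit normal to $\partial\mathcal D$, wherever it exists. Classical means that $u^\pm$ is $C^1$ in $(x,t)$ up to the boundary of $\Omega^\pm(t)$, $t\in[0,T)$, that $p^\pm(\cdot,t)$ is $C^1$ up to the boundary of $\Omega^\pm(t)$, and that the Lagrangian flow map $\eta$ of $u^-$ on $\overline{\Omega^-}$ ($\eta(x,0)=x$, $\partial_t\eta(x,t)=u^-(\eta(x,t),t)$, $\eta(\Gamma,t)=\Gamma(t)$) is $C^1$ on $\Gamma\times[0,T)$. Set $\delta u=u^+-u^-$ on $\Gamma(t)$ and $\|f\|_{W^{k,\infty}(\Gamma(t))}=\sum_{i=0}^k\|\nabla^i_{\mathcal T}f\|_{L^\infty(\Gamma(t))}$. **Assumptions.** There is $\mathcal M<\infty$ with $$\sup_{t\in[0,T)}\left(\|u^+(\cdot,t)\|_{W^{2,\infty}(\Gamma(t))}+\|H(\cdot,t)\|_{W^{2,\infty}(\Gamma(t))}\right)<\mathcal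 M ,$$ and there is a sequence $t_n\to T$, $t_n\in[0,T)$, with $$\max_{x\in\Gamma}\left|[\nabla_{\mathcal T}\delta u\cdot\mathcal T](\eta(x,t_n),t_n)\right|\to\infty .$$ **Conclusion.** On $\Gamma(t)$ put $\mathfrak A=2\,\nabla_{\mathcal T}u^+\cdot\mathcal T$ and $\mathcal A=(\delta u\cdot\mathcal T)\,\nabla_{\mathcal T}(\nabla_{\mathcal T}u^+\cdot\mathcal T)+\nabla_{\mathcal T}(\nabla_{\mathcal T}H)$. Then $$c_6:=\sup_{t\in[0,T)}\big\|\,|\mathfrak A|+|\mathcal A|\,\big\|_{L^\infty(\Gamma(t))}<\infty ,$$ and for every $0<\epsilon\le T$ there is $t_0(\epsilon)\in[T-\epsilon,T)$ such that $$\|\nabla_{\mathcal T}u^-\cdot\mathcal T(\cdot,t)\|_{L^\infty(\Gamma(t))}\le\frac{1+(1+2c_6)(T-t)}{T-t}\qquad\text{for all }t\in[t_0(\epsilon),T).$$ -/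

import Mathlib

open MeasureTheory Set Filter Topology
open scoped ENNReal

noncomputable section

/-- The plane `ℝ²` with its Euclidean structure. -/
abbrev Plane : Type := EuclideanSpace ℝ (Fin 2)

namespace VortexSheet

/-! ### Calculus on a parametrized closed curve

A closed curve is given by a `1`-periodic regular `C¹` parametrization `c : ℝ → Plane`; a function
`f` on the curve is represented by its pullback to the parameter `s`. -/

section Curve

variable {E : Type*} [NormedAddCommGroup E] [NormedSpace ℝ E]

/-- Rotation by a right angle, `x^⊥ = (-x₂, x₁)`. -/
def perp (x : Plane) : Plane := !₂[-x 1, x 0]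

/-- The tangential derivative `∇_T f = G f'` along the curve `c`, where `G = 1 / |c'|`
(the derivative with respect to arclength). -/
def tanDeriv (c : ℝ → Plane) (f : ℝ → E) : ℝ → E := fun s => ‖deriv c s‖⁻¹ • deriv f s

/-- The unit tangent `τ = G c'`. -/
def unitTangent (c : ℝ → Plane) : ℝ → Plane := tanDeriv c c

/-- The unit normal `n = τ^⊥`. -/
def unitNormal (c : ℝ → Plane) : ℝ → Plane := fun s => perp (unitTangent c s)

/-- The curvature `H`: the derivative of the unit normal is `∇_T n = H τ`, that is,
`∇_T τ = - H n`. It is positive on a circle whose unit normal points outward. -/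
def curvature (c : ℝ → Plane) : ℝ → ℝ :=
  fun s => - inner ℝ (tanDeriv c (unitTangent c) s) (unitNormal c s)

/-- Membership in `W^{k,∞}` of the curve, for `k ≥ 1`: the tangential derivatives of order
`< k` are Lipschitz (so that those of order `< k` exist classically and the one of order `k`
exists almost everywhere and is essentially bounded). -/
def MemW (k : ℕ) (c : ℝ → Plane) (f : ℝ → E) : Prop :=
  ∀ i < k, ∃ K : NNReal, LipschitzWith K ((tanDeriv c)^[i] f)

/-- The norm `∑_{i ≤ k} ‖∇_T^i f‖_{L^∞}` of `W^{k,∞}` of the curve. -/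
def wNorm (k : ℕ) (c : ℝ → Plane) (f : ℝ → E) : ℝ≥0∞ :=
  ∑ i ∈ Finset.range (k + 1), eLpNorm ((tanDeriv c)^[i] f) ∞ volume

end Curve

/-! ### Domains and regularity up to the boundary -/

/-- `f` is `C¹` on `S` (typically a closed domain, so that this is `C¹` up to the boundary):
it is differentiable relative to `S` at every point of `S`, with a derivative that is continuous
on `S`. -/
def IsC1On {X Y : Type*} [NormedAddCommGroup X] [NormedSpace ℝ X]
    [NormedAddCommGroup Y] [NormedSpace ℝ Y] (f : X → Y) (S : Set X) : Prop :=
  ∃ f' : X → (X →L[ℝ] Y), ContinuousOn f' S ∧ ∀ q ∈ S, HasFDerivWithinAt f (f' q) S q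

/-- `ν` is the outward unit normal of `Ω` at the boundary point `x`; in particular `Ω` lies locally
on one side of its boundary near `x`. -/
def IsOutwardUnitNormal (Ω : Set Plane) (x ν : Plane) : Prop :=
  ‖ν‖ = 1 ∧
  (∀ w : Plane, inner ℝ w ν < 0 → ∀ᶠ h : ℝ in 𝓝[>] 0, x + h • w ∈ Ω) ∧
  (∀ w : Plane, 0 < inner ℝ w ν → ∀ᶠ h : ℝ in 𝓝[>] 0, x + h • w ∉ Ω)

/-- The open space-time region swept by `Ω t`, `0 < t < T`. -/
def spaceTime (T : ℝ) (Ω : ℝ → Set Plane) : Set (ℝ × Plane) :=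
  {q | q.1 ∈ Ioo 0 T ∧ q.2 ∈ Ω q.1}

/-- The space-time region swept by the closures of `Ω t`, `0 ≤ t < T`. -/
def closedSpaceTime (T : ℝ) (Ω : ℝ → Set Plane) : Set (ℝ × Plane) :=
  {q | q.1 ∈ Ico 0 T ∧ q.2 ∈ closure (Ω q.1)}

/-- The partial derivative `∂ u_j / ∂ x_i` of a planar vector field. -/
def partialD (u : Plane → Plane) (i j : Fin 2) (x : Plane) : ℝ :=
  (fderiv ℝ u x (EuclideanSpace.single i 1)) j

/-- Divergence of a planar vector field. -/
def div (u : Plane → Plane) (x : Plane) : ℝ := partialD u 0 0 x + partialD u 1 1 x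

/-- Scalar curl of a planar vector field. -/
def curl (u : Plane → Plane) (x : Plane) : ℝ := partialD u 0 1 x - partialD u 1 0 x

/-- The vertical unit vector. -/
def e₂ : Plane := EuclideanSpace.single 1 1

/-- The momentum equation `u_t + u · Du + Dp = - g e₂` (unit density) at time `t` and place `x`. -/
def MomentumAt (g : ℝ) (u : ℝ → Plane → Plane) (p : ℝ → Plane → ℝ) (t : ℝ) (x : Plane) : Prop :=
  deriv (fun r => u r x) t + fderiv ℝ (u t) x (u t x) + gradient (p t) x = -(g • e₂)

/-! ### Two-fluid flows -/

/-- The unknowns of a planar two-fluid flow: container, the two fluid regions, velocities and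
pressures, a parametrization `θ` of the initial interface, and the Lagrangian flow map `η` of the
velocity `um`. The suffixes `p` and `m` stand for the superscripts `+` and `-`. -/
structure Flow where
  D : Set Plane
  Ωp : ℝ → Set Plane
  Ωm : ℝ → Set Plane
  up : ℝ → Plane → Plane
  um : ℝ → Plane → Plane
  pp : ℝ → Plane → ℝ
  pm : ℝ → Plane → ℝ
  θ : ℝ → Plane
  η : ℝ → Plane → Plane

namespace Flow

variable (F : Flow)

/-- The Lagrangian parametrization `s ↦ η(θ(s), t)` of the interface `Γ(t)`. -/
def z (t : ℝ) : ℝ → Plane := fun s => F.η t (F.θ s)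

/-- The interface `Γ(t)`. -/
def Γ (t : ℝ) : Set Plane := range (F.z t)

/-- The unit tangent `τ` at `η(θ(s), t)`. -/
def τ (t : ℝ) : ℝ → Plane := unitTangent (F.z t)

/-- The unit normal `n` at `η(θ(s), t)`. -/
def n (t : ℝ) : ℝ → Plane := unitNormal (F.z t)

/-- The curvature `H` of `Γ(t)` at `η(θ(s), t)`. -/
def H (t : ℝ) : ℝ → ℝ := curvature (F.z t)

/-- `v⁺ = u⁺ ∘ η` on the interface. -/
def vp (t : ℝ) : ℝ → Plane := fun s => F.up t (F.z t s)

/-- `v⁻ = u⁻ ∘ η` on the interface. -/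
def vm (t : ℝ) : ℝ → Plane := fun s => F.um t (F.z t s)

/-- The velocity jump `δv = v⁺ - v⁻`. -/
def δv (t : ℝ) : ℝ → Plane := fun s => F.vp t s - F.vm t s

/-- `∇_T u⁺ · T`. -/
def stretchP (t : ℝ) : ℝ → ℝ := fun s => inner ℝ (tanDeriv (F.z t) (F.vp t) s) (F.τ t s)

/-- The tangential stretching rate `∇_T u⁻ · T`. -/
def stretchM (t : ℝ) : ℝ → ℝ := fun s => inner ℝ (tanDeriv (F.z t) (F.vm t) s) (F.τ t s)

/-- `∇_T δu · T`. -/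
def stretchJump (t : ℝ) : ℝ → ℝ := fun s => inner ℝ (tanDeriv (F.z t) (F.δv t) s) (F.τ t s)

/-- The coefficient `𝔄 = 2 ∇_T u⁺ · T`. -/
def coeffA (t : ℝ) : ℝ → ℝ := fun s => 2 * F.stretchP t s

/-- The forcing `𝒜 = (δu · T) ∇_T (∇_T u⁺ · T) + ∇_T (∇_T H)`. -/
def forcing (t : ℝ) : ℝ → ℝ := fun s =>
  inner ℝ (F.δv t s) (F.τ t s) * tanDeriv (F.z t) (F.stretchP t) s
    + tanDeriv (F.z t) (tanDeriv (F.z t) (F.H t)) s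

/-- The constant `c₆ = sup_{t, x} (|𝔄| + |𝒜|)`, the supremum over the interface being essential
because `𝒜` is only an `L^∞` function there. -/
def c6 (T : ℝ) : ℝ≥0∞ :=
  ⨆ t ∈ Ico 0 T, eLpNorm (fun s => |F.coeffA t s| + |F.forcing t s|) ∞ volume

/-- `F` is a classical solution on `[0, T)` of the incompressible irrotational two-fluid Euler
equations with gravity `g`, unit densities and unit surface tension, with non-self-intersecting
interface of class `W^{4,∞}`. -/
structure IsSolution (T g : ℝ) : Prop where
  -- geometry of the container and of the initial configuration
  D_open : IsOpen F.D
  D_bounded : Bornology.IsBounded F.D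
  D_connected : IsConnected F.D
  Ωp_connected : IsConnected (F.Ωp 0)
  Ωm_connected : IsConnected (F.Ωm 0)
  Γ_initial : range F.θ = closure (F.Ωp 0) ∩ closure (F.Ωm 0)
  θ_periodic : Function.Periodic F.θ 1
  θ_regular : ContDiff ℝ 1 F.θ ∧ ∀ s, deriv F.θ s ≠ 0
  -- the moving fluid regions and the interface separating them
  Ωp_open : ∀ t ∈ Ico 0 T, IsOpen (F.Ωp t)
  Ωm_open : ∀ t ∈ Ico 0 T, IsOpen (F.Ωm t)
  Ωp_spaceTime : IsOpen (spaceTime T F.Ωp)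
  Ωm_spaceTime : IsOpen (spaceTime T F.Ωm)
  decomposition : ∀ t ∈ Ico 0 T, F.D = F.Ωp t ∪ F.Γ t ∪ F.Ωm t
  disjoint_pm : ∀ t ∈ Ico 0 T, Disjoint (F.Ωp t) (F.Ωm t)
  disjoint_pΓ : ∀ t ∈ Ico 0 T, Disjoint (F.Ωp t) (F.Γ t)
  disjoint_mΓ : ∀ t ∈ Ico 0 T, Disjoint (F.Ωm t) (F.Γ t)
  Γ_simple : ∀ t ∈ Ico 0 T, InjOn (F.z t) (Ico 0 1)
  Γ_class : ∀ t ∈ Ico 0 T, MemW 4 (F.z t) (F.z t)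
  -- the unit normal points into `Ω⁻(t)`; both regions are locally on one side of `Γ(t)`
  normal_p : ∀ t ∈ Ico 0 T, ∀ s, IsOutwardUnitNormal (F.Ωp t) (F.z t s) (F.n t s)
  normal_m : ∀ t ∈ Ico 0 T, ∀ s, IsOutwardUnitNormal (F.Ωm t) (F.z t s) (-F.n t s)
  -- regularity
  up_C1 : IsC1On (fun q : ℝ × Plane => F.up q.1 q.2) (closedSpaceTime T F.Ωp)
  um_C1 : IsC1On (fun q : ℝ × Plane => F.um q.1 q.2) (closedSpaceTime T F.Ωm)
  pp_C1 : ∀ t ∈ Ioo 0 T, IsC1On (F.pp t) (closure (F.Ωp t))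
  pm_C1 : ∀ t ∈ Ioo 0 T, IsC1On (F.pm t) (closure (F.Ωm t))
  -- the Lagrangian flow of `u⁻`
  η_zero : ∀ x ∈ closure (F.Ωm 0), F.η 0 x = x
  η_mem : ∀ t ∈ Ico 0 T, ∀ x ∈ closure (F.Ωm 0), F.η t x ∈ closure (F.Ωm t)
  η_deriv : ∀ t ∈ Ico 0 T, ∀ x ∈ closure (F.Ωm 0),
    HasDerivWithinAt (fun r => F.η r x) (F.um t (F.η t x)) (Ico 0 T) t
  η_C1 : IsC1On (fun q : ℝ × ℝ => F.z q.1 q.2) (Ico 0 T ×ˢ univ)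
  -- the Euler equations
  momentum_p : ∀ t ∈ Ioo 0 T, ∀ x ∈ F.Ωp t, MomentumAt g F.up F.pp t x
  momentum_m : ∀ t ∈ Ioo 0 T, ∀ x ∈ F.Ωm t, MomentumAt g F.um F.pm t x
  curl_p : ∀ t ∈ Ico 0 T, ∀ x ∈ F.Ωp t, curl (F.up t) x = 0
  curl_m : ∀ t ∈ Ico 0 T, ∀ x ∈ F.Ωm t, curl (F.um t) x = 0
  div_p : ∀ t ∈ Ico 0 T, ∀ x ∈ F.Ωp t, div (F.up t) x = 0
  div_m : ∀ t ∈ Ico 0 T, ∀ x ∈ F.Ωm t, div (F.um t) x = 0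
  pressure_jump : ∀ t ∈ Ioo 0 T, ∀ s, F.pp t (F.z t s) - F.pm t (F.z t s) = F.H t s
  normal_jump : ∀ t ∈ Ico 0 T, ∀ s, inner ℝ (F.up t (F.z t s) - F.um t (F.z t s)) (F.n t s) = 0
  wall : ∀ t ∈ Ico 0 T, ∀ x ∈ frontier F.D, ∀ N, IsOutwardUnitNormal F.D x N →
    inner ℝ (F.um t x) N = 0
  normal_speed : ∀ t ∈ Ioo 0 T, ∀ s,
    inner ℝ (deriv (fun r => F.z r s) t) (F.n t s) = inner ℝ (F.up t (F.z t s)) (F.n t s)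

/-- The a priori bound
`sup_{t ∈ [0,T)} (‖u⁺‖_{W^{2,∞}(Γ(t))} + ‖H‖_{W^{2,∞}(Γ(t))}) < M`. -/
def Bounds (T M : ℝ) : Prop :=
  (∀ t ∈ Ico 0 T, MemW 2 (F.z t) (F.vp t) ∧ MemW 2 (F.z t) (F.H t)) ∧
  ⨆ t ∈ Ico 0 T, (wNorm 2 (F.z t) (F.vp t) + wNorm 2 (F.z t) (F.H t)) < ENNReal.ofReal M

/-- The blow-up assumption: `max_Γ |∇_T δu · T| → ∞` along some sequence `t_k → T`. -/
def BlowUp (T : ℝ) : Prop :=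
  ∃ tk : ℕ → ℝ, (∀ k, tk k ∈ Ico 0 T) ∧ Tendsto tk atTop (𝓝 T) ∧
    Tendsto (fun k => ⨆ s, |F.stretchJump (tk k) s|) atTop atTop

end Flow

end VortexSheet

end

/-! Along the particles of `u⁻` put ℓ = |∂ₛz|, w = δu·T, a = ∇_T u⁺·T and X = ∇_T δu·T. Pairing the
two momentum equations with T and subtracting gives w_t = -∇_T H - a w (`hasDerivAt_slip_time`);
moreover w_s = ℓX (`hasDerivAt_slip`) and ℓ_t = ℓ(a - X) (`hasDerivAt_speed_time`). Differentiating
the first equation in s gives, formally, the Riccati equation X_t = X² - 𝔄X - 𝒜, whose coefficients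
satisfy |𝔄| + |𝒜| ≤ c₆. Finiteness of c₆ reduces to a bound on w, which is a Grönwall estimate for
its linear equation.

Comparison with subsolutions does the rest. A large negative constant bounds X from below. If X(t)
exceeded 1/(T - t) + c₆ + 1, the subsolution 1/(S - t) + c₆ + 1 with some S < T would force X to
blow up at S, where it is still continuous. Since ∇_T u⁻·T = a - X with 2|a| ≤ c₆, both bounds pass
to `u⁻`.

The obstacle is regularity: 𝒜 is only an L^∞ function on the curve, so X need not be differentiable
in time. The comparison therefore works with ℓX = w_s and with lower bounds on its right time
slopes, obtained from increments of w_t in s (`eventually_mul_sub_le`, `riccati_barrier`). -/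

/-! ### One-variable calculus and the Riccati comparison principle. -/

section Analysis

variable {E : Type*} [NormedAddCommGroup E] [NormedSpace ℝ E]

/-- A Lipschitz function whose derivative is continuous is continuously differentiable. -/
theorem LipschitzWith.hasDerivAt_of_continuous_deriv [FiniteDimensional ℝ E] {K : NNReal}
    {f : ℝ → E} (hf : LipschitzWith K f) (hc : Continuous (deriv f)) (x : ℝ) :
    HasDerivAt f (deriv f x) x := by
  have hint : ∀ y, HasDerivAt (fun y => ∫ r in (0 : ℝ)..y, deriv f r) (deriv f y) y := fun y =>
    intervalIntegral.integral_hasDerivAt_right (hc.intervalIntegrable _ _)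
      hc.stronglyMeasurable.stronglyMeasurableAtFilter hc.continuousAt
  -- The difference between `f` and the primitive of `deriv f` is absolutely continuous with
  -- derivative zero almost everywhere, hence constant.
  have hac : AbsolutelyContinuousOnInterval
      (fun y => f y - ∫ r in (0 : ℝ)..y, deriv f r) (x - 1) (x + 1) := by
    refine (hf.lipschitzOnWith).absolutelyContinuousOnInterval.sub ?_
    refine ContDiffOn.absolutelyContinuousOnInterval (ContDiff.contDiffOn ?_)
    rw [contDiff_one_iff_deriv]
    refine ⟨fun y => (hint y).differentiableAt, ?_⟩
    rwa [show deriv (fun y => ∫ r in (0 : ℝ)..y, deriv f r) = deriv f from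
      funext fun y => (hint y).deriv]
  obtain ⟨C, hC⟩ := hac.const_of_ae_hasDerivAt_zero (by
    filter_upwards [hf.ae_differentiableAt_real] with y hy _
    simpa using hy.hasDerivAt.fun_sub (hint y))
  refine ((hint x).add_const C).congr_of_eventuallyEq ?_
  filter_upwards [Ioo_mem_nhds (by linarith : x - 1 < x) (by linarith : x < x + 1)] with y hy
  have := hC y (by rw [uIcc_of_le (by linarith)]; exact Ioo_subset_Icc_self hy)
  rw [← this]; simp

/-- An absolutely continuous function with almost everywhere derivative at least `κ` grows at
rate at least `κ`. -/
theorem AbsolutelyContinuousOnInterval.mul_sub_le_of_le_deriv {f : ℝ → ℝ} {a b κ : ℝ}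
    (hab : a ≤ b) (hf : AbsolutelyContinuousOnInterval f a b)
    (hκ : ∀ᵐ x, x ∈ Icc a b → κ ≤ deriv f x) : κ * (b - a) ≤ f b - f a := by
  rw [← hf.integral_deriv_eq_sub]
  have := intervalIntegral.integral_mono_ae_restrict (μ := volume) hab
    (intervalIntegrable_const (c := κ)) hf.intervalIntegrable_deriv
    ((ae_restrict_iff' measurableSet_Icc).2 hκ)
  simpa [mul_comm] using this

theorem ae_norm_le_of_eLpNorm_top_le {E : Type*} [NormedAddCommGroup E] {f : ℝ → E} {M : ℝ}
    (hM : 0 ≤ M) (h : eLpNorm f ∞ volume ≤ ENNReal.ofReal M) : ∀ᵐ s, ‖f s‖ ≤ M := by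
  filter_upwards [ae_le_eLpNormEssSup (f := f) (μ := volume)] with s hs
  rw [eLpNorm_exponent_top] at h
  have := hs.trans h
  rwa [← ofReal_norm, ENNReal.ofReal_le_ofReal_iff hM] at this

/-- A continuous function is bounded everywhere by its essential supremum. -/
theorem norm_le_of_eLpNorm_top_le {E : Type*} [NormedAddCommGroup E] {f : ℝ → E} (hf : Continuous f) {M : ℝ} (hM : 0 ≤ M)
    (h : eLpNorm f ∞ volume ≤ ENNReal.ofReal M) (s : ℝ) : ‖f s‖ ≤ M := by
  have hae := ae_norm_le_of_eLpNorm_top_le hM h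
  have hcl : IsClosed {s | ‖f s‖ ≤ M} := isClosed_le hf.norm continuous_const
  have := (Measure.dense_of_ae hae).closure_eq
  rw [hcl.closure_eq] at this
  exact eq_univ_iff_forall.1 this s

/-- Commutation of mixed partial derivatives: `∂_t ∂_s f = ∂_s ∂_t f` at a point where
`∂_s ∂_t f` is continuous. -/
theorem hasDerivAt_partial_of_continuousAt {f g k : ℝ → ℝ → E} {p : ℝ → E} {U : Set ℝ} {t s : ℝ}
    (hU : U ∈ 𝓝 t) (hg : ∀ r ∈ U, ∀ σ, HasDerivAt (fun r => f r σ) (g r σ) r)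
    (hk : ∀ r ∈ U, ∀ σ, HasDerivAt (g r) (k r σ) σ)
    (hp : ∀ r ∈ U, HasDerivAt (f r) (p r) s)
    (hcont : ContinuousAt (fun q : ℝ × ℝ => k q.1 q.2) (t, s)) :
    HasDerivAt p (k t s) t := by
  rw [hasDerivAt_iff_isLittleO, Asymptotics.isLittleO_iff]
  intro ε hε
  have hnear : ∀ᶠ q : ℝ × ℝ in 𝓝 (t, s), q.1 ∈ U ∧ ‖k q.1 q.2 - k t s‖ ≤ ε := by
    refine ((continuous_fst.tendsto (t, s)).eventually hU).and ?_
    have : Tendsto (fun q : ℝ × ℝ => ‖k q.1 q.2 - k t s‖) (𝓝 (t, s)) (𝓝 0) := by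
      simpa using (hcont.tendsto.sub_const (k t s)).norm
    exact this.eventually (Iic_mem_nhds hε)
  obtain ⟨δ, hδ, hball⟩ := Metric.eventually_nhds_iff.1 hnear
  filter_upwards [Metric.ball_mem_nhds t hδ] with r hr
  have hpt : ∀ ρ ∈ Metric.ball t δ, ∀ σ ∈ Metric.ball s δ,
      ρ ∈ U ∧ ‖k ρ σ - k t s‖ ≤ ε := fun ρ hρ σ hσ =>
    hball (y := (ρ, σ)) (by rw [Prod.dist_eq]; exact max_lt hρ hσ)
  have hs : s ∈ Metric.ball s δ := Metric.mem_ball_self hδ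
  have ht : t ∈ Metric.ball t δ := Metric.mem_ball_self hδ
  -- The mean value inequality is applied in space and then in time, bounding the double increment
  -- of `f` uniformly; letting σ → s at the end turns it into an increment of `p`.
  have hspace : ∀ ρ ∈ Metric.ball t δ, ∀ σ ∈ Metric.ball s δ,
      ‖g ρ σ - g ρ s - (σ - s) • k t s‖ ≤ ε * ‖σ - s‖ := by
    intro ρ hρ σ hσ
    have := Convex.norm_image_sub_le_of_norm_hasDerivWithin_le
      (f := fun σ => g ρ σ - σ • k t s) (f' := fun σ => k ρ σ - k t s)
      (fun x hx => by
        simpa using (((hk ρ (hpt ρ hρ x hx).1 x).fun_sub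
          ((hasDerivAt_id x).smul_const (k t s))).hasDerivWithinAt))
      (fun x hx => (hpt ρ hρ x hx).2) (convex_ball s δ) hs hσ
    convert this using 2
    module
  have htime : ∀ σ ∈ Metric.ball s δ,
      ‖(f r σ - f r s) - (f t σ - f t s) - ((r - t) * (σ - s)) • k t s‖
        ≤ ε * ‖σ - s‖ * ‖r - t‖ := by
    intro σ hσ
    have := Convex.norm_image_sub_le_of_norm_hasDerivWithin_le
      (f := fun ρ => f ρ σ - f ρ s - ρ • ((σ - s) • k t s))
      (f' := fun ρ => g ρ σ - g ρ s - (σ - s) • k t s)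
      (fun x hx => by
        simpa using ((((hg x (hpt x hx s hs).1 σ).fun_sub (hg x (hpt x hx s hs).1 s)).fun_sub
          ((hasDerivAt_id x).smul_const ((σ - s) • k t s))).hasDerivWithinAt))
      (fun x hx => hspace x hx σ hσ) (convex_ball t δ) ht hr
    convert this using 2
    module
  have hlim : Tendsto (fun σ => ‖slope (f r) s σ - slope (f t) s σ - (r - t) • k t s‖)
      (𝓝[≠] s) (𝓝 ‖p r - p t - (r - t) • k t s‖) := by
    refine Tendsto.norm (Tendsto.sub_const (Tendsto.sub ?_ ?_) _)
    · exact hasDerivAt_iff_tendsto_slope.1 (hp r (hpt r hr s hs).1)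
    · exact hasDerivAt_iff_tendsto_slope.1 (hp t (hpt t ht s hs).1)
  refine le_of_tendsto hlim ?_
  filter_upwards [self_mem_nhdsWithin, nhdsWithin_le_nhds (Metric.ball_mem_nhds s hδ)]
    with σ hne hσ
  have hne' : σ - s ≠ 0 := sub_ne_zero.2 hne
  have h1 := htime σ hσ
  have : slope (f r) s σ - slope (f t) s σ - (r - t) • k t s =
      (σ - s)⁻¹ • ((f r σ - f r s) - (f t σ - f t s) - ((r - t) * (σ - s)) • k t s) := by
    simp only [slope_def_module]
    rw [smul_sub _ _ (((r - t) * (σ - s)) • k t s), smul_smul,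
      show (σ - s)⁻¹ * ((r - t) * (σ - s)) = r - t by field_simp, ← smul_sub]
  rw [this, norm_smul, norm_inv, inv_mul_le_iff₀ (norm_pos_iff.2 hne')]
  linarith

/-- If the mixed difference quotients of `∂_t f` in the second variable are at least `κ`, then
`∂_s f` grows in time at rate at least `κ`. -/
theorem mul_sub_le_partial_sub {f g : ℝ → ℝ → ℝ} {p : ℝ → ℝ} {t r s κ δ : ℝ} (hδ : 0 < δ)
    (htr : t ≤ r)
    (hg : ∀ ρ ∈ Icc t r, ∀ σ, HasDerivAt (fun ρ => f ρ σ) (g ρ σ) ρ)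
    (hκ : ∀ ρ ∈ Icc t r, ∀ h ∈ Ioo 0 δ, κ * h ≤ g ρ (s + h) - g ρ s)
    (hp : ∀ ρ ∈ Icc t r, HasDerivAt (f ρ) (p ρ) s) :
    κ * (r - t) ≤ p r - p t := by
  have htime : ∀ h ∈ Ioo 0 δ, κ * h * (r - t) ≤ (f r (s + h) - f r s) - (f t (s + h) - f t s) := by
    intro h hh
    have hmono : MonotoneOn (fun ρ => f ρ (s + h) - f ρ s - κ * h * ρ) (Icc t r) := by
      have hd : ∀ ρ ∈ Icc t r, HasDerivAt (fun ρ => f ρ (s + h) - f ρ s - κ * h * ρ)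
          (g ρ (s + h) - g ρ s - κ * h) ρ := fun ρ hρ => by
        simpa using ((hg ρ hρ (s + h)).fun_sub (hg ρ hρ s)).fun_sub ((hasDerivAt_id ρ).const_mul (κ * h))
      refine monotoneOn_of_deriv_nonneg (convex_Icc t r)
        (fun ρ hρ => (hd ρ hρ).continuousAt.continuousWithinAt)
        (fun ρ hρ => (hd ρ (interior_subset hρ)).differentiableAt.differentiableWithinAt) ?_
      intro ρ hρ
      rw [(hd ρ (interior_subset hρ)).deriv]
      linarith [hκ ρ (interior_subset hρ) h hh]
    have := hmono (left_mem_Icc.2 htr) (right_mem_Icc.2 htr) htr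
    simp only at this
    linarith
  have hlim : Tendsto (fun h => h⁻¹ • (f r (s + h) - f r s) - h⁻¹ • (f t (s + h) - f t s))
      (𝓝[>] 0) (𝓝 (p r - p t)) :=
    Tendsto.sub (hp r (right_mem_Icc.2 htr)).tendsto_slope_zero_right
      (hp t (left_mem_Icc.2 htr)).tendsto_slope_zero_right
  refine ge_of_tendsto hlim ?_
  filter_upwards [Ioo_mem_nhdsGT hδ] with h hh
  rw [← smul_sub, smul_eq_mul, le_inv_mul_iff₀ hh.1]
  linarith [htime h hh]

/-- Barrier argument for the Riccati inequality `X' ≥ X² - 2 a X - c + 2 |a|`, in conservative form: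
`W = ℓ X` and `ℓ' = ℓ (a - X)`. -/
theorem riccati_barrier {ℓ a X y y' : ℝ → ℝ} {t₀ t₁ c : ℝ}
    (hX : ContinuousOn X (Icc t₀ t₁))
    (hℓ : ∀ t ∈ Icc t₀ t₁, HasDerivAt ℓ (ℓ t * (a t - X t)) t) (hpos : ∀ t ∈ Icc t₀ t₁, 0 < ℓ t)
    (ha : ∀ t ∈ Icc t₀ t₁, 2 * |a t| ≤ c)
    (hslope : ∀ t ∈ Ico t₀ t₁, ∀ κ < ℓ t * (2 * |a t| - c - a t * X t),
      ∀ᶠ r in 𝓝[>] t, κ * (r - t) ≤ ℓ r * X r - ℓ t * X t)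
    (hy : ∀ t ∈ Icc t₀ t₁, HasDerivAt y (y' t) t)
    (hy' : ∀ t ∈ Icc t₀ t₁, y' t < y t ^ 2 - c * |y t|) (hone : ∀ t ∈ Icc t₀ t₁, 1 ≤ |y t|)
    (hinit : y t₀ ≤ X t₀) {t : ℝ} (ht : t ∈ Icc t₀ t₁) : y t ≤ X t := by
  have h₀ : t₀ ∈ Icc t₀ t₁ := left_mem_Icc.2 (ht.1.trans ht.2)
  have hℓc : ContinuousOn ℓ (Icc t₀ t₁) := fun t ht => (hℓ t ht).continuousAt.continuousWithinAt
  have hBd : ∀ t ∈ Icc t₀ t₁, HasDerivAt (fun t => -(ℓ t * y t))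
      (-(ℓ t * (a t - X t) * y t + ℓ t * y' t)) t := fun t ht => ((hℓ t ht).mul (hy t ht)).neg
  have key := image_le_of_liminf_slope_right_lt_deriv_boundary'
    -- The library comparison bounds a function from above, hence the signs; `ℓ X` is compared
    -- instead of `X` because only its slopes are controlled.
    (f := fun t => -(ℓ t * X t)) (f' := fun t => -(ℓ t * (2 * |a t| - c - a t * X t)))
    (B := fun t => -(ℓ t * y t)) (a := t₀) (b := t₁)
    (hℓc.mul hX).neg ?_ ?_ (fun t ht => (hBd t ht).continuousAt.continuousWithinAt)
    (fun t ht => (hBd t (Ico_subset_Icc_self ht)).hasDerivWithinAt) ?_ ht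
  · have := hpos t ht
    simp only [neg_le_neg_iff] at key
    exact le_of_mul_le_mul_left key this
  · intro x hx r hr
    obtain ⟨κ, hκ, hκ'⟩ := exists_between hr
    refine Eventually.frequently ?_
    filter_upwards [hslope x hx (-κ) (by linarith), self_mem_nhdsWithin] with z hz hxz
    have hxz : 0 < z - x := sub_pos.2 hxz
    rw [slope_def_field, div_lt_iff₀ hxz]
    nlinarith
  · have := hpos _ h₀
    simp only [neg_le_neg_iff]
    gcongr
  · intro x hx heq
    have hx := Ico_subset_Icc_self hx
    have hℓx := hpos x hx
    have hXy : X x = y x := by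
      have : ℓ x * X x = ℓ x * y x := by simpa using heq
      exact mul_left_cancel₀ hℓx.ne' this
    rw [hXy, neg_lt_neg_iff]
    -- Here `|y| ≥ 1` enters: it absorbs the zeroth-order term, as `2|a||y| + (c - 2|a|) ≤ c|y|`.
    have h1 : 0 ≤ (c - 2 * |a x|) * (|y x| - 1) :=
      mul_nonneg (by linarith [ha x hx]) (by linarith [hone x hx])
    have h2 : a x * y x ≤ |a x| * |y x| := by rw [← abs_mul]; exact le_abs_self _
    have h3 := hy' x hx
    have h4 : (a x - y x) * y x + y' x < 2 * |a x| - c - a x * y x := by nlinarith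
    nlinarith

end Analysis

theorem ContinuousOn.continuousAt_Ioo_prod {E : Type*} [TopologicalSpace E]
    {f : ℝ × ℝ → E} {a b : ℝ} (hf : ContinuousOn f (Ico a b ×ˢ univ)) {t : ℝ}
    (ht : t ∈ Ioo a b) (s : ℝ) : ContinuousAt f (t, s) :=
  hf.continuousAt (prod_mem_nhds (Ico_mem_nhds ht.1 ht.2) univ_mem)

/-! ### Moving frames, chain rules up to the boundary, and the momentum equation on the closure. -/

namespace VortexSheet

/-- Coordinates of a vector in the orthonormal frame of a unit vector and its rotation. -/
theorem eq_inner_smul_add_inner_perp_smul {e : Plane} (he : ‖e‖ = 1) (x : Plane) :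
    x = (inner ℝ x e : ℝ) • e + (inner ℝ x (perp e) : ℝ) • perp e := by
  have h : e 0 ^ 2 + e 1 ^ 2 = 1 := by
    have := EuclideanSpace.real_norm_sq_eq e
    rw [he, Fin.sum_univ_two] at this
    linarith
  ext i
  fin_cases i
  · simp [perp, PiLp.inner_apply, Fin.sum_univ_two]
    linear_combination -(x 0) * h
  · simp [perp, PiLp.inner_apply, Fin.sum_univ_two]
    linear_combination -(x 1) * h

theorem norm_perp (x : Plane) : ‖perp x‖ = ‖x‖ := by
  simp [perp, EuclideanSpace.norm_eq, Fin.sum_univ_two, add_comm]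

section Trace

variable {E : Type*} [NormedAddCommGroup E] [NormedSpace ℝ E] {T : ℝ} {Ω : ℝ → Set Plane}
  {u : ℝ → Plane → E} {u' : ℝ × Plane → (ℝ × Plane →L[ℝ] E)}

/-- Chain rule along a curve at a fixed time. -/
theorem hasDerivAt_comp_curve
    (hu : ∀ q ∈ closedSpaceTime T Ω,
      HasFDerivWithinAt (fun q : ℝ × Plane => u q.1 q.2) (u' q) (closedSpaceTime T Ω) q)
    {t : ℝ} (ht : t ∈ Ico 0 T) {c : ℝ → Plane} {c' : Plane} {s : ℝ} (hc : HasDerivAt c c' s)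
    (hmem : ∀ σ, c σ ∈ closure (Ω t)) :
    HasDerivAt (fun σ => u t (c σ)) (u' (t, c s) (0, c')) s := by
  have hcurve : HasDerivWithinAt (fun σ => (t, c σ)) ((0 : ℝ), c') univ s :=
    ((hasDerivAt_const s t).prodMk hc).hasDerivWithinAt
  exact hasDerivWithinAt_univ.1 (HasFDerivWithinAt.comp_hasDerivWithinAt s (hu _ ⟨ht, hmem s⟩)
    hcurve (fun σ _ => ⟨ht, hmem σ⟩))

/-- Chain rule along a trajectory. -/
theorem hasDerivAt_comp_trajectory
    (hu : ∀ q ∈ closedSpaceTime T Ω,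
      HasFDerivWithinAt (fun q : ℝ × Plane => u q.1 q.2) (u' q) (closedSpaceTime T Ω) q)
    {t : ℝ} (ht : t ∈ Ioo 0 T) {c : ℝ → Plane} {c' : Plane} (hc : HasDerivAt c c' t)
    (hmem : ∀ r ∈ Ico 0 T, c r ∈ closure (Ω r)) :
    HasDerivAt (fun r => u r (c r)) (u' (t, c t) (1, c')) t := by
  have hcurve : HasDerivWithinAt (fun r => (r, c r)) ((1 : ℝ), c') (Ico 0 T) t :=
    ((hasDerivAt_id t).prodMk hc).hasDerivWithinAt
  have ht' := Ioo_subset_Ico_self ht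
  exact (HasFDerivWithinAt.comp_hasDerivWithinAt t (hu _ ⟨ht', hmem t ht'⟩)
    hcurve (fun r hr => ⟨hr, hmem r hr⟩)).hasDerivAt (Ico_mem_nhds ht.1 ht.2)

end Trace

/-- The momentum equation extends by continuity to the closure of the fluid region. -/
theorem momentum_closure {T g : ℝ} {Ω : ℝ → Set Plane} {u : ℝ → Plane → Plane}
    {p : ℝ → Plane → ℝ} {u' : ℝ × Plane → (ℝ × Plane →L[ℝ] Plane)} {p' : Plane → (Plane →L[ℝ] ℝ)}
    (hu : ∀ q ∈ closedSpaceTime T Ω,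
      HasFDerivWithinAt (fun q : ℝ × Plane => u q.1 q.2) (u' q) (closedSpaceTime T Ω) q)
    (hu' : ContinuousOn u' (closedSpaceTime T Ω))
    (hopen : IsOpen (spaceTime T Ω)) {t : ℝ} (ht : t ∈ Ioo 0 T) (hΩ : IsOpen (Ω t))
    (hp : ∀ x ∈ closure (Ω t), HasFDerivWithinAt (p t) (p' x) (closure (Ω t)) x)
    (hp' : ContinuousOn p' (closure (Ω t)))
    (hmom : ∀ x ∈ Ω t, MomentumAt g u p t x) {x : Plane} (hx : x ∈ closure (Ω t)) (v : Plane) :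
    inner ℝ (u' (t, x) (1, u t x)) v + p' x v = inner ℝ (-(g • e₂)) v := by
  have ht' := Ioo_subset_Ico_self ht
  have hmaps : MapsTo (fun x => (t, x)) (closure (Ω t)) (closedSpaceTime T Ω) :=
    fun x hx => ⟨ht', hx⟩
  have hpair : ContinuousOn (fun x : Plane => (t, x)) (closure (Ω t)) := by fun_prop
  have hut : ContinuousOn (u t) (closure (Ω t)) :=
    (show ContinuousOn (fun q : ℝ × Plane => u q.1 q.2) (closedSpaceTime T Ω) from
      fun q hq => (hu q hq).continuousWithinAt).comp hpair hmaps
  have hcont : ContinuousOn (fun x => inner ℝ (u' (t, x) (1, u t x)) v + p' x v)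
      (closure (Ω t)) := by
    refine ContinuousOn.add (ContinuousOn.inner (𝕜 := ℝ) ?_ continuousOn_const)
      (hp'.clm_apply continuousOn_const)
    exact (hu'.comp hpair hmaps).clm_apply (continuousOn_const.prodMk hut)
  refine Set.EqOn.of_subset_closure (s := Ω t) ?_ hcont continuousOn_const subset_closure
    subset_rfl hx
  intro x hx
  -- Openness of the region in space-time upgrades the relative derivative to a full one, so that it
  -- determines the `deriv` and `fderiv` of `MomentumAt`.
  have hst : HasFDerivAt (fun q : ℝ × Plane => u q.1 q.2) (u' (t, x)) (t, x) := by
    refine (hu _ ⟨ht', subset_closure hx⟩).hasFDerivAt (mem_of_superset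
      (hopen.mem_nhds (show (t, x) ∈ spaceTime T Ω from ⟨ht, hx⟩)) ?_)
    exact fun q hq => ⟨Ioo_subset_Ico_self hq.1, subset_closure hq.2⟩
  have htime : deriv (fun r => u r x) t = u' (t, x) (1, 0) :=
    (HasFDerivAt.comp_hasDerivAt t (f := fun r => (r, x)) hst
      ((hasDerivAt_id t).prodMk (hasDerivAt_const t x))).deriv
  have hspace : fderiv ℝ (u t) x = (u' (t, x)).comp (ContinuousLinearMap.inr ℝ ℝ Plane) :=
    (hst.comp x (hasFDerivAt_prodMk_right t x)).fderiv
  have hpx : HasFDerivAt (p t) (p' x) x :=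
    (hp x (subset_closure hx)).hasFDerivAt (mem_of_superset (hΩ.mem_nhds hx) subset_closure)
  have hgrad : inner ℝ (gradient (p t) x) v = p' x v := by
    rw [gradient, hpx.fderiv, InnerProductSpace.toDual_symm_apply]
  have := hmom x hx
  rw [MomentumAt, htime, hspace] at this
  simp only
  rw [← this, inner_add_left, hgrad, ContinuousLinearMap.comp_apply,
    ContinuousLinearMap.inr_apply, ← map_add]
  simp

/-! ### Regularity of the interface and of the velocity traces. -/

namespace Flow

variable {F : Flow} {T g : ℝ}

namespace IsSolution

variable (hF : F.IsSolution T g)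
include hF

theorem θ_mem (s : ℝ) : F.θ s ∈ closure (F.Ωm 0) :=
  (hF.Γ_initial ▸ mem_range_self s : F.θ s ∈ closure (F.Ωp 0) ∩ closure (F.Ωm 0)).2

theorem z_mem_m {t : ℝ} (ht : t ∈ Ico 0 T) (s : ℝ) : F.z t s ∈ closure (F.Ωm t) :=
  hF.η_mem t ht _ (hF.θ_mem s)

theorem norm_n {t : ℝ} (ht : t ∈ Ico 0 T) (s : ℝ) : ‖F.n t s‖ = 1 := (hF.normal_p t ht s).1

theorem norm_τ {t : ℝ} (ht : t ∈ Ico 0 T) (s : ℝ) : ‖F.τ t s‖ = 1 := by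
  rw [← hF.norm_n ht s, n, unitNormal, norm_perp]; rfl

/-- Small steps from the interface against the outward normal enter `Ωp t`. -/
theorem z_mem_p {t : ℝ} (ht : t ∈ Ico 0 T) (s : ℝ) : F.z t s ∈ closure (F.Ωp t) := by
  have hn := hF.norm_n ht s
  have hev := (hF.normal_p t ht s).2.1 (-F.n t s) (by
    rw [inner_neg_left, real_inner_self_eq_norm_sq, hn]; norm_num)
  have hlim : Tendsto (fun h : ℝ => F.z t s + h • -F.n t s) (𝓝[>] 0) (𝓝 (F.z t s)) := by
    have : Continuous fun h : ℝ => F.z t s + h • -F.n t s := by fun_prop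
    simpa using (this.tendsto 0).mono_left nhdsWithin_le_nhds
  exact mem_closure_of_tendsto hlim hev

/-- The normal is a unit vector, whereas at a zero of `deriv (F.z t)` the definition of
`unitTangent` would give zero. -/
theorem deriv_z_ne_zero {t : ℝ} (ht : t ∈ Ico 0 T) (s : ℝ) : deriv (F.z t) s ≠ 0 := by
  intro h
  have := hF.norm_τ ht s
  simp [τ, unitTangent, tanDeriv, h] at this

theorem speed_pos {t : ℝ} (ht : t ∈ Ico 0 T) (s : ℝ) : 0 < ‖deriv (F.z t) s‖ :=
  norm_pos_iff.2 (hF.deriv_z_ne_zero ht s)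

theorem deriv_z_eq {t : ℝ} (ht : t ∈ Ico 0 T) (s : ℝ) :
    deriv (F.z t) s = ‖deriv (F.z t) s‖ • F.τ t s := by
  rw [τ, unitTangent, tanDeriv, smul_smul, mul_inv_cancel₀ (hF.speed_pos ht s).ne', one_smul]

theorem continuousOn_z : ContinuousOn (fun q : ℝ × ℝ => F.z q.1 q.2) (Ico 0 T ×ˢ univ) := by
  obtain ⟨_, -, h⟩ := hF.η_C1
  exact fun q hq => (h q hq).continuousWithinAt

theorem hasDerivAt_z_and_continuousOn :
    (∀ t ∈ Ico 0 T, ∀ s, HasDerivAt (F.z t) (deriv (F.z t) s) s) ∧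
      ContinuousOn (fun q : ℝ × ℝ => deriv (F.z q.1) q.2) (Ico 0 T ×ˢ univ) := by
  obtain ⟨z', hz', h⟩ := hF.η_C1
  have hd : ∀ t ∈ Ico 0 T, ∀ s, HasDerivAt (F.z t) (z' (t, s) (0, 1)) s := fun t ht s => by
    have hcurve : HasDerivWithinAt (fun σ : ℝ => (t, σ)) ((0 : ℝ), (1 : ℝ)) univ s :=
      ((hasDerivAt_const s t).prodMk (hasDerivAt_id s)).hasDerivWithinAt
    exact hasDerivWithinAt_univ.1 (HasFDerivWithinAt.comp_hasDerivWithinAt s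
      (h (t, s) ⟨ht, mem_univ s⟩) hcurve (fun σ _ => ⟨ht, mem_univ σ⟩))
  refine ⟨fun t ht s => (hd t ht s).differentiableAt.hasDerivAt, ?_⟩
  refine (hz'.clm_apply (continuousOn_const (c := ((0 : ℝ), (1 : ℝ))))).congr fun q hq => ?_
  exact (hd q.1 hq.1 q.2).deriv

theorem hasDerivAt_z {t : ℝ} (ht : t ∈ Ico 0 T) (s : ℝ) :
    HasDerivAt (F.z t) (deriv (F.z t) s) s := hF.hasDerivAt_z_and_continuousOn.1 t ht s

/-- The trace on the interface of a `C¹` velocity field is `C¹` along the interface. -/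
theorem trace_regular {Ω : ℝ → Set Plane} {u : ℝ → Plane → Plane}
    (hu : IsC1On (fun q : ℝ × Plane => u q.1 q.2) (closedSpaceTime T Ω))
    (hmem : ∀ t ∈ Ico 0 T, ∀ s, F.z t s ∈ closure (Ω t)) :
    ContinuousOn (fun q : ℝ × ℝ => u q.1 (F.z q.1 q.2)) (Ico 0 T ×ˢ univ) ∧
      (∀ t ∈ Ico 0 T, ∀ s, HasDerivAt (fun s => u t (F.z t s))
        (deriv (fun s => u t (F.z t s)) s) s) ∧
      ContinuousOn (fun q : ℝ × ℝ => deriv (fun s => u q.1 (F.z q.1 s)) q.2)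
        (Ico 0 T ×ˢ univ) := by
  obtain ⟨u', hu', h⟩ := hu
  have hpair : ContinuousOn (fun q : ℝ × ℝ => (q.1, F.z q.1 q.2)) (Ico 0 T ×ˢ univ) :=
    continuousOn_fst.prodMk hF.continuousOn_z
  have hmaps : MapsTo (fun q : ℝ × ℝ => (q.1, F.z q.1 q.2)) (Ico 0 T ×ˢ univ)
      (closedSpaceTime T Ω) := fun q hq => ⟨hq.1, hmem _ hq.1 _⟩
  have hd := fun t ht s => hasDerivAt_comp_curve h (t := t) ht (hF.hasDerivAt_z ht s) (hmem t ht)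
  refine ⟨?_, fun t ht s => (hd t ht s).differentiableAt.hasDerivAt, ?_⟩
  · exact (show ContinuousOn (fun q : ℝ × Plane => u q.1 q.2) (closedSpaceTime T Ω) from
      fun q hq => (h q hq).continuousWithinAt).comp hpair hmaps
  · refine ((hu'.comp hpair hmaps).clm_apply
      ((continuousOn_const (c := (0 : ℝ))).prodMk hF.hasDerivAt_z_and_continuousOn.2)).congr fun q hq => ?_
    exact (hd q.1 hq.1 q.2).deriv

theorem vp_regular : ContinuousOn (fun q : ℝ × ℝ => F.vp q.1 q.2) (Ico 0 T ×ˢ univ) ∧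
    (∀ t ∈ Ico 0 T, ∀ s, HasDerivAt (F.vp t) (deriv (F.vp t) s) s) ∧
    ContinuousOn (fun q : ℝ × ℝ => deriv (F.vp q.1) q.2) (Ico 0 T ×ˢ univ) :=
  hF.trace_regular hF.up_C1 fun _ ht => hF.z_mem_p ht

theorem vm_regular : ContinuousOn (fun q : ℝ × ℝ => F.vm q.1 q.2) (Ico 0 T ×ˢ univ) ∧
    (∀ t ∈ Ico 0 T, ∀ s, HasDerivAt (F.vm t) (deriv (F.vm t) s) s) ∧
    ContinuousOn (fun q : ℝ × ℝ => deriv (F.vm q.1) q.2) (Ico 0 T ×ˢ univ) :=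
  hF.trace_regular hF.um_C1 fun _ ht => hF.z_mem_m ht

theorem hasDerivAt_z_time {t : ℝ} (ht : t ∈ Ioo 0 T) (s : ℝ) :
    HasDerivAt (fun r => F.z r s) (F.vm t s) t :=
  (hF.η_deriv t (Ioo_subset_Ico_self ht) _ (hF.θ_mem s)).hasDerivAt (Ico_mem_nhds ht.1 ht.2)

theorem hasDerivAt_deriv_z_time {t : ℝ} (ht : t ∈ Ioo 0 T) (s : ℝ) :
    HasDerivAt (fun r => deriv (F.z r) s) (deriv (F.vm t) s) t :=
  hasDerivAt_partial_of_continuousAt (f := F.z) (g := F.vm) (k := fun t => deriv (F.vm t))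
    (Ioo_mem_nhds ht.1 ht.2) (fun _ hr σ => hF.hasDerivAt_z_time hr σ)
    (fun _ hr σ => hF.vm_regular.2.1 _ (Ioo_subset_Ico_self hr) σ)
    (fun _ hr => hF.hasDerivAt_z (Ioo_subset_Ico_self hr) s)
    (hF.vm_regular.2.2.continuousAt_Ioo_prod ht s)

end IsSolution

end Flow

end VortexSheet

theorem inner_deriv_eq_zero_of_norm_eq_one {f : ℝ → Plane} {f' : Plane} {s : ℝ}
    (hf : HasDerivAt f f' s) (hnorm : ∀ᶠ σ in 𝓝 s, ‖f σ‖ = 1) : inner ℝ (f s) f' = (0 : ℝ) := by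
  have h1 : HasDerivAt (fun σ => ‖f σ‖ ^ 2) 0 s :=
    (hasDerivAt_const s (1 : ℝ)).congr_of_eventuallyEq (hnorm.mono fun σ hσ => by simp [hσ])
  have := hf.norm_sq.unique h1
  linarith

namespace VortexSheet

/-! ### Evolution equations on the interface: tangential jump, arclength speed and tangent. -/

namespace Flow

variable {F : Flow} {T g : ℝ}

/-- The tangential velocity jump `δu · T`. -/
noncomputable def slip (F : Flow) (t : ℝ) : ℝ → ℝ := fun s => inner ℝ (F.δv t s) (F.τ t s)

/-- The speed of the Lagrangian parametrization of the interface. -/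
noncomputable def speed (F : Flow) (t : ℝ) : ℝ → ℝ := fun s => ‖deriv (F.z t) s‖

theorem deriv_eq_speed_smul {E : Type*} [NormedAddCommGroup E] [NormedSpace ℝ E] (f : ℝ → E)
    {t s : ℝ} (h : 0 < F.speed t s) : deriv f s = F.speed t s • tanDeriv (F.z t) f s := by
  rw [tanDeriv, smul_smul]
  change _ = (F.speed t s * (F.speed t s)⁻¹) • _
  rw [mul_inv_cancel₀ h.ne', one_smul]

namespace IsSolution

variable (hF : F.IsSolution T g)
include hF

theorem δv_eq {t : ℝ} (ht : t ∈ Ico 0 T) (s : ℝ) : F.δv t s = F.slip t s • F.τ t s := by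
  have h := eq_inner_smul_add_inner_perp_smul (hF.norm_τ ht s) (F.δv t s)
  have h0 : inner ℝ (F.δv t s) (perp (F.τ t s)) = (0 : ℝ) := hF.normal_jump t ht s
  rw [h0, zero_smul, add_zero] at h
  exact h

theorem stretchJump_eq {t : ℝ} (ht : t ∈ Ico 0 T) (s : ℝ) :
    F.stretchJump t s = F.stretchP t s - F.stretchM t s := by
  have : deriv (F.δv t) s = deriv (F.vp t) s - deriv (F.vm t) s :=
    ((hF.vp_regular.2.1 t ht s).fun_sub (hF.vm_regular.2.1 t ht s)).deriv
  simp only [stretchJump, stretchP, stretchM, tanDeriv, this, smul_sub, inner_sub_left]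

theorem continuousOn_speed :
    ContinuousOn (fun q : ℝ × ℝ => F.speed q.1 q.2) (Ico 0 T ×ˢ univ) :=
  hF.hasDerivAt_z_and_continuousOn.2.norm

theorem continuousOn_tanDeriv {f : ℝ → ℝ → Plane}
    (hf : ContinuousOn (fun q : ℝ × ℝ => deriv (f q.1) q.2) (Ico 0 T ×ˢ univ)) :
    ContinuousOn (fun q : ℝ × ℝ => tanDeriv (F.z q.1) (f q.1) q.2) (Ico 0 T ×ˢ univ) :=
  (hF.continuousOn_speed.inv₀ fun q hq => (hF.speed_pos hq.1 q.2).ne').smul hf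

theorem continuousOn_τ : ContinuousOn (fun q : ℝ × ℝ => F.τ q.1 q.2) (Ico 0 T ×ˢ univ) :=
  hF.continuousOn_tanDeriv (f := F.z) hF.hasDerivAt_z_and_continuousOn.2

theorem continuousOn_stretchP :
    ContinuousOn (fun q : ℝ × ℝ => F.stretchP q.1 q.2) (Ico 0 T ×ˢ univ) :=
  ContinuousOn.inner (𝕜 := ℝ) (hF.continuousOn_tanDeriv hF.vp_regular.2.2) hF.continuousOn_τ

theorem continuousOn_stretchM :
    ContinuousOn (fun q : ℝ × ℝ => F.stretchM q.1 q.2) (Ico 0 T ×ˢ univ) :=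
  ContinuousOn.inner (𝕜 := ℝ) (hF.continuousOn_tanDeriv hF.vm_regular.2.2) hF.continuousOn_τ

theorem continuousOn_stretchJump :
    ContinuousOn (fun q : ℝ × ℝ => F.stretchJump q.1 q.2) (Ico 0 T ×ˢ univ) :=
  (hF.continuousOn_stretchP.sub hF.continuousOn_stretchM).congr
    fun q hq => hF.stretchJump_eq hq.1 q.2

theorem continuousOn_slip : ContinuousOn (fun q : ℝ × ℝ => F.slip q.1 q.2) (Ico 0 T ×ˢ univ) :=
  ContinuousOn.inner (𝕜 := ℝ) (hF.vp_regular.1.sub hF.vm_regular.1) hF.continuousOn_τ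

omit hF in
theorem _root_.ContinuousOn.continuous_slice {E : Type*} [TopologicalSpace E] {f : ℝ × ℝ → E}
    {U : Set ℝ} (hf : ContinuousOn f (U ×ˢ univ)) {t : ℝ} (ht : t ∈ U) :
    Continuous fun s => f (t, s) :=
  hf.comp_continuous (by fun_prop) fun _ => ⟨ht, mem_univ _⟩

omit hF in
theorem _root_.ContinuousOn.continuousOn_slice {E : Type*} [TopologicalSpace E] {f : ℝ × ℝ → E}
    {U : Set ℝ} (hf : ContinuousOn f (U ×ˢ univ)) (s : ℝ) :
    ContinuousOn (fun t => f (t, s)) U :=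
  hf.comp (by fun_prop) fun _ ht => ⟨ht, mem_univ _⟩

theorem exists_lipschitzWith_τ {t : ℝ} (ht : t ∈ Ico 0 T) : ∃ K, LipschitzWith K (F.τ t) :=
  hF.Γ_class t ht 1 (by norm_num)

theorem hasDerivAt_τ {t : ℝ} (ht : t ∈ Ico 0 T) (s : ℝ) :
    HasDerivAt (F.τ t) (deriv (F.τ t) s) s := by
  obtain ⟨K, hK⟩ := hF.exists_lipschitzWith_τ ht
  obtain ⟨K', hK'⟩ : ∃ K', LipschitzWith K' (tanDeriv (F.z t) (F.τ t)) :=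
    hF.Γ_class t ht 2 (by norm_num)
  refine hK.hasDerivAt_of_continuous_deriv ?_ s
  rw [show deriv (F.τ t) = fun s => F.speed t s • tanDeriv (F.z t) (F.τ t) s from
    funext fun s => deriv_eq_speed_smul _ (hF.speed_pos ht s)]
  exact (hF.continuousOn_speed.continuous_slice ht).smul hK'.continuous

theorem norm_tanDeriv_τ {t : ℝ} (ht : t ∈ Ico 0 T) (s : ℝ) :
    ‖tanDeriv (F.z t) (F.τ t) s‖ = |F.H t s| := by
  have h0 := inner_deriv_eq_zero_of_norm_eq_one (hF.hasDerivAt_τ ht s)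
    (Eventually.of_forall fun σ => hF.norm_τ ht σ)
  have h1 : inner ℝ (tanDeriv (F.z t) (F.τ t) s) (F.τ t s) = (0 : ℝ) := by
    rw [tanDeriv, inner_smul_left, real_inner_comm, h0, mul_zero]
  have h2 := eq_inner_smul_add_inner_perp_smul (hF.norm_τ ht s) (tanDeriv (F.z t) (F.τ t) s)
  rw [h1, zero_smul, zero_add] at h2
  rw [h2, norm_smul, norm_perp, hF.norm_τ ht s, mul_one, H, curvature, abs_neg]
  rfl

/-- The term δv·τ_s drops out: δv is tangential because its normal component vanishes, and τ_s is
normal. -/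
theorem hasDerivAt_slip {t : ℝ} (ht : t ∈ Ico 0 T) (s : ℝ) :
    HasDerivAt (F.slip t) (F.speed t s * F.stretchJump t s) s := by
  have hδ : HasDerivAt (F.δv t) (deriv (F.δv t) s) s :=
    ((hF.vp_regular.2.1 t ht s).fun_sub
      (hF.vm_regular.2.1 t ht s)).differentiableAt.hasDerivAt
  have h0 := inner_deriv_eq_zero_of_norm_eq_one (hF.hasDerivAt_τ ht s)
    (Eventually.of_forall fun σ => hF.norm_τ ht σ)
  refine (hδ.inner ℝ (hF.hasDerivAt_τ ht s)).congr_deriv (Eq.symm ?_)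
  rw [hF.δv_eq ht s, inner_smul_left, h0, mul_zero, zero_add,
    deriv_eq_speed_smul (F.δv t) (hF.speed_pos ht s), inner_smul_left]
  rfl

/-- The parametrization moves with `u⁻`, so z_s has time derivative (v⁻)_s, whose tangential part is
the stretching rate. -/
theorem hasDerivAt_speed_time {t : ℝ} (ht : t ∈ Ioo 0 T) (s : ℝ) :
    HasDerivAt (fun r => F.speed r s) (F.speed t s * F.stretchM t s) t := by
  have ht' := Ioo_subset_Ico_self ht
  have hpos := hF.speed_pos ht' s
  have h := ((hF.hasDerivAt_deriv_z_time ht s).norm_sq).sqrt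
    (pow_ne_zero 2 hpos.ne')
  simp only [Real.sqrt_sq (norm_nonneg _)] at h
  refine HasDerivAt.congr_deriv (f := fun r => F.speed r s) h (Eq.symm ?_)
  rw [hF.deriv_z_eq ht' s, norm_smul, norm_norm, hF.norm_τ ht' s, mul_one, inner_smul_left,
    deriv_eq_speed_smul (F.vm t) hpos, inner_smul_right, real_inner_comm]
  change _ = 2 * (F.speed t s * (F.speed t s * F.stretchM t s)) / (2 * F.speed t s)
  have : F.speed t s ≠ 0 := hpos.ne'
  field_simp

theorem exists_hasDerivAt_τ_time {t : ℝ} (ht : t ∈ Ioo 0 T) (s : ℝ) :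
    ∃ τ' : Plane, HasDerivAt (fun r => F.τ r s) τ' t ∧ inner ℝ (F.τ t s) τ' = (0 : ℝ) := by
  have hpos := hF.speed_pos (Ioo_subset_Ico_self ht) s
  have h := ((hF.hasDerivAt_speed_time ht s).inv hpos.ne').smul (hF.hasDerivAt_deriv_z_time ht s)
  refine ⟨_, h, inner_deriv_eq_zero_of_norm_eq_one (f := fun r => F.τ r s) h ?_⟩
  filter_upwards [Ioo_mem_nhds ht.1 ht.2] with r hr
  exact hF.norm_τ (Ioo_subset_Ico_self hr) s

/-- Evolution of the tangential velocity jump along the flow of `u⁻`. -/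
theorem hasDerivAt_slip_time {t : ℝ} (ht : t ∈ Ioo 0 T) (s : ℝ) :
    HasDerivAt (fun r => F.slip r s)
      (-tanDeriv (F.z t) (F.H t) s - F.slip t s * F.stretchP t s) t := by
  have ht' := Ioo_subset_Ico_self ht
  have hpos := hF.speed_pos ht' s
  obtain ⟨up', hup', hup⟩ := hF.up_C1
  obtain ⟨um', hum', hum⟩ := hF.um_C1
  obtain ⟨pp', hpp', hpp⟩ := hF.pp_C1 t ht
  obtain ⟨pm', hpm', hpm⟩ := hF.pm_C1 t ht
  obtain ⟨τ', hτ', hττ'⟩ := hF.exists_hasDerivAt_τ_time ht s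
  set x := F.z t s with hx
  have hp := momentum_closure hup hup' hF.Ωp_spaceTime ht (hF.Ωp_open t ht') hpp hpp'
    (hF.momentum_p t ht) (hF.z_mem_p ht' s) (F.τ t s)
  have hm := momentum_closure hum hum' hF.Ωm_spaceTime ht (hF.Ωm_open t ht') hpm hpm'
    (hF.momentum_m t ht) (hF.z_mem_m ht' s) (F.τ t s)
  have hvp := hasDerivAt_comp_trajectory hup ht (hF.hasDerivAt_z_time ht s)
    (fun r hr => hF.z_mem_p hr s)
  have hvm := hasDerivAt_comp_trajectory hum ht (hF.hasDerivAt_z_time ht s)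
    (fun r hr => hF.z_mem_m hr s)
  have hτ : F.τ t s = (F.speed t s)⁻¹ • deriv (F.z t) s := rfl
  have hP : tanDeriv (F.z t) (F.vp t) s = up' (t, x) (0, F.τ t s) := by
    have : HasDerivAt (F.vp t) (up' (t, x) (0, deriv (F.z t) s)) s :=
      hasDerivAt_comp_curve hup ht' (hF.hasDerivAt_z ht' s) (hF.z_mem_p ht')
    rw [tanDeriv, this.deriv, hτ, ← map_smul]
    simp [speed]
  -- Tangential differentiation of the pressure jump condition.
  have hH : tanDeriv (F.z t) (F.H t) s = pp' x (F.τ t s) - pm' x (F.τ t s) := by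
    have h1 : HasDerivAt (fun σ => F.pp t (F.z t σ)) (pp' x (deriv (F.z t) s)) s :=
      hasDerivWithinAt_univ.1 (HasFDerivWithinAt.comp_hasDerivWithinAt s
        (hpp _ (hF.z_mem_p ht' s)) (hF.hasDerivAt_z ht' s).hasDerivWithinAt
        fun σ _ => hF.z_mem_p ht' σ)
    have h2 : HasDerivAt (fun σ => F.pm t (F.z t σ)) (pm' x (deriv (F.z t) s)) s :=
      hasDerivWithinAt_univ.1 (HasFDerivWithinAt.comp_hasDerivWithinAt s
        (hpm _ (hF.z_mem_m ht' s)) (hF.hasDerivAt_z ht' s).hasDerivWithinAt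
        fun σ _ => hF.z_mem_m ht' σ)
    have h3 : HasDerivAt (F.H t) (pp' x (deriv (F.z t) s) - pm' x (deriv (F.z t) s)) s :=
      (h1.fun_sub h2).congr_of_eventuallyEq
        (Eventually.of_forall fun σ => (hF.pressure_jump t ht σ).symm)
    rw [tanDeriv, h3.deriv, hτ, map_smul, map_smul, ← smul_sub]
    rfl
  have hδ : HasDerivAt (fun r => F.δv r s)
      (up' (t, x) (1, F.vm t s) - um' (t, x) (1, F.vm t s)) t := hvp.fun_sub hvm
  -- Particles of `u⁻` carry `u⁺` too; replacing `u⁻` by `u⁺ - wT` in the material derivative costs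
  -- the term w ∇_T u⁺. Gravity cancels when the two momentum equations are subtracted.
  have hsplit : up' (t, x) (1, F.vm t s) =
      up' (t, x) (1, F.up t x) - F.slip t s • up' (t, x) (0, F.τ t s) := by
    have : ((1 : ℝ), F.vm t s) = (1, F.up t x) - F.slip t s • ((0 : ℝ), F.τ t s) := by
      rw [Prod.smul_mk, ← hF.δv_eq ht' s]
      simp [δv, vp, hx]
    rw [this, map_sub, map_smul]
  refine (hδ.inner ℝ hτ').congr_deriv (Eq.symm ?_)
  rw [hF.δv_eq ht' s, inner_smul_left, hττ', mul_zero, zero_add, hsplit, hH, inner_sub_left,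
    inner_sub_left, inner_smul_left, ← hP]
  change _ = inner ℝ (up' (t, x) (1, F.up t x)) (F.τ t s) - F.slip t s * F.stretchP t s
    - inner ℝ (um' (t, x) (1, F.um t x)) (F.τ t s)
  linarith

end IsSolution

end Flow

end VortexSheet

/-! ### A priori bounds and finiteness of c₆. -/

theorem Function.Periodic.deriv_periodic {E : Type*} [NormedAddCommGroup E] [NormedSpace ℝ E]
    {f : ℝ → E} {c : ℝ} (hf : Function.Periodic f c) : Function.Periodic (_root_.deriv f) c := by
  intro s
  rw [← deriv_comp_add_const]
  exact congrFun (congrArg _root_.deriv (funext hf)) s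

theorem Function.Periodic.exists_norm_le {E : Type*} [NormedAddCommGroup E] {f : ℝ → E}
    (hf : Function.Periodic f 1) (hc : Continuous f) : ∃ C, ∀ s, ‖f s‖ ≤ C := by
  obtain ⟨C, hC⟩ := isCompact_Icc.exists_bound_of_continuousOn (s := Icc (0 : ℝ) 1) hc.continuousOn
  refine ⟨C, fun s => ?_⟩
  obtain ⟨y, hy, hys⟩ := hf.exists_mem_Ico₀ one_pos s
  exact hys ▸ hC y (Ico_subset_Icc_self hy)

namespace VortexSheet

theorem tanDeriv_periodic {E : Type*} [NormedAddCommGroup E] [NormedSpace ℝ E] {c : ℝ → Plane}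
    {f : ℝ → E} (hc : Function.Periodic c 1) (hf : Function.Periodic f 1) :
    Function.Periodic (tanDeriv c f) 1 := fun s => by
  simp only [tanDeriv, hc.deriv_periodic s, hf.deriv_periodic s]

namespace Flow

variable {F : Flow} {T g M : ℝ}

namespace Bounds

theorem pos (hb : F.Bounds T M) : 0 < M :=
  ENNReal.ofReal_pos.1 (bot_le.trans_lt hb.2)

theorem eLpNorm_le (hb : F.Bounds T M) {t : ℝ} (ht : t ∈ Ico 0 T) {i : ℕ} (hi : i < 3) :
    eLpNorm ((tanDeriv (F.z t))^[i] (F.vp t)) ∞ volume ≤ ENNReal.ofReal M ∧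
      eLpNorm ((tanDeriv (F.z t))^[i] (F.H t)) ∞ volume ≤ ENNReal.ofReal M := by
  have h := (le_iSup₂ (f := fun t (_ : t ∈ Ico 0 T) =>
    wNorm 2 (F.z t) (F.vp t) + wNorm 2 (F.z t) (F.H t)) t ht).trans hb.2.le
  have hv : eLpNorm ((tanDeriv (F.z t))^[i] (F.vp t)) ∞ volume ≤ wNorm 2 (F.z t) (F.vp t) :=
    Finset.single_le_sum (f := fun i => eLpNorm ((tanDeriv (F.z t))^[i] (F.vp t)) ∞ volume)
      (fun _ _ => bot_le) (Finset.mem_range.2 hi)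
  have hH : eLpNorm ((tanDeriv (F.z t))^[i] (F.H t)) ∞ volume ≤ wNorm 2 (F.z t) (F.H t) :=
    Finset.single_le_sum (f := fun i => eLpNorm ((tanDeriv (F.z t))^[i] (F.H t)) ∞ volume)
      (fun _ _ => bot_le) (Finset.mem_range.2 hi)
  exact ⟨hv.trans (le_self_add.trans h), hH.trans (le_add_self.trans h)⟩

theorem abs_H_le (hb : F.Bounds T M) {t : ℝ} (ht : t ∈ Ico 0 T) (s : ℝ) : |F.H t s| ≤ M := by
  obtain ⟨K, hK⟩ := (hb.1 t ht).2 0 (by norm_num)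
  exact norm_le_of_eLpNorm_top_le hK.continuous hb.pos.le (hb.eLpNorm_le ht (by norm_num)).2 s

theorem abs_tanDeriv_H_le (hb : F.Bounds T M) {t : ℝ} (ht : t ∈ Ico 0 T) (s : ℝ) :
    |tanDeriv (F.z t) (F.H t) s| ≤ M := by
  obtain ⟨K, hK⟩ := (hb.1 t ht).2 1 (by norm_num)
  exact norm_le_of_eLpNorm_top_le hK.continuous hb.pos.le (hb.eLpNorm_le ht (by norm_num)).2 s

theorem norm_tanDeriv_vp_le (hb : F.Bounds T M) {t : ℝ} (ht : t ∈ Ico 0 T) (s : ℝ) :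
    ‖tanDeriv (F.z t) (F.vp t) s‖ ≤ M := by
  obtain ⟨K, hK⟩ := (hb.1 t ht).1 1 (by norm_num)
  exact norm_le_of_eLpNorm_top_le hK.continuous hb.pos.le (hb.eLpNorm_le ht (by norm_num)).1 s

theorem ae_norm_tanDeriv_tanDeriv_vp_le (hb : F.Bounds T M) {t : ℝ} (ht : t ∈ Ico 0 T) :
    ∀ᵐ s, ‖tanDeriv (F.z t) (tanDeriv (F.z t) (F.vp t)) s‖ ≤ M :=
  ae_norm_le_of_eLpNorm_top_le hb.pos.le (hb.eLpNorm_le ht (i := 2) (by norm_num)).1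

theorem ae_abs_tanDeriv_tanDeriv_H_le (hb : F.Bounds T M) {t : ℝ} (ht : t ∈ Ico 0 T) :
    ∀ᵐ s, |tanDeriv (F.z t) (tanDeriv (F.z t) (F.H t)) s| ≤ M :=
  ae_norm_le_of_eLpNorm_top_le hb.pos.le (hb.eLpNorm_le ht (i := 2) (by norm_num)).2

end Bounds

namespace IsSolution

variable (hF : F.IsSolution T g)
include hF

theorem abs_stretchP_le (hb : F.Bounds T M) {t : ℝ} (ht : t ∈ Ico 0 T) (s : ℝ) :
    |F.stretchP t s| ≤ M := by
  have h := abs_real_inner_le_norm (tanDeriv (F.z t) (F.vp t) s) (F.τ t s)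
  rw [hF.norm_τ ht s, mul_one] at h
  exact h.trans (hb.norm_tanDeriv_vp_le ht s)

/-- Provides the absolute continuity in s needed to integrate the almost-everywhere bound on 𝒜. -/
theorem exists_lipschitzWith_stretchP (hb : F.Bounds T M) {t : ℝ} (ht : t ∈ Ico 0 T) :
    ∃ K, LipschitzWith K (F.stretchP t) := by
  obtain ⟨K, hK⟩ : ∃ K, LipschitzWith K (tanDeriv (F.z t) (F.vp t)) :=
    (hb.1 t ht).1 1 (by norm_num)
  obtain ⟨K', hK'⟩ := hF.exists_lipschitzWith_τ ht
  refine ⟨K + M.toNNReal * K', LipschitzWith.of_dist_le_mul fun x y => ?_⟩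
  have hsub : F.stretchP t x - F.stretchP t y =
      inner ℝ (tanDeriv (F.z t) (F.vp t) x - tanDeriv (F.z t) (F.vp t) y) (F.τ t x)
        + inner ℝ (tanDeriv (F.z t) (F.vp t) y) (F.τ t x - F.τ t y) := by
    simp only [stretchP, inner_sub_left, inner_sub_right]; ring
  have h1 := norm_inner_le_norm (𝕜 := ℝ)
    (tanDeriv (F.z t) (F.vp t) x - tanDeriv (F.z t) (F.vp t) y) (F.τ t x)
  have h2 := norm_inner_le_norm (𝕜 := ℝ) (tanDeriv (F.z t) (F.vp t) y) (F.τ t x - F.τ t y)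
  have h3 := hK.dist_le_mul x y
  have h4 := hK'.dist_le_mul x y
  rw [hF.norm_τ ht, mul_one] at h1
  rw [dist_eq_norm] at h3 h4
  rw [dist_eq_norm, hsub]
  refine (norm_add_le _ _).trans ?_
  have h5 : ‖tanDeriv (F.z t) (F.vp t) y‖ * ‖F.τ t x - F.τ t y‖ ≤ M * (K' * dist x y) :=
    mul_le_mul (hb.norm_tanDeriv_vp_le ht y) h4 (norm_nonneg _) hb.pos.le
  push_cast
  rw [Real.coe_toNNReal _ hb.pos.le]
  linarith

theorem ae_abs_tanDeriv_stretchP_le (hb : F.Bounds T M) {t : ℝ} (ht : t ∈ Ico 0 T) :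
    ∀ᵐ s, |tanDeriv (F.z t) (F.stretchP t) s| ≤ M + M * M := by
  obtain ⟨K, hK⟩ : ∃ K, LipschitzWith K (tanDeriv (F.z t) (F.vp t)) :=
    (hb.1 t ht).1 1 (by norm_num)
  filter_upwards [hK.ae_differentiableAt_real, hb.ae_norm_tanDeriv_tanDeriv_vp_le ht]
    with s hd hs
  have h : HasDerivAt (F.stretchP t) _ s := hd.hasDerivAt.inner ℝ (hF.hasDerivAt_τ ht s)
  have heq : tanDeriv (F.z t) (F.stretchP t) s =
      inner ℝ (tanDeriv (F.z t) (F.vp t) s) (tanDeriv (F.z t) (F.τ t) s)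
        + inner ℝ (tanDeriv (F.z t) (tanDeriv (F.z t) (F.vp t)) s) (F.τ t s) := by
    rw [tanDeriv, h.deriv]
    simp only [tanDeriv, inner_smul_left, inner_smul_right, smul_eq_mul, mul_add]
    simp
  have h1 := norm_inner_le_norm (𝕜 := ℝ) (tanDeriv (F.z t) (F.vp t) s)
    (tanDeriv (F.z t) (F.τ t) s)
  have h2 := norm_inner_le_norm (𝕜 := ℝ)
    (tanDeriv (F.z t) (tanDeriv (F.z t) (F.vp t)) s) (F.τ t s)
  rw [hF.norm_τ ht, mul_one] at h2
  rw [hF.norm_tanDeriv_τ ht] at h1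
  have h3 : ‖tanDeriv (F.z t) (F.vp t) s‖ * |F.H t s| ≤ M * M :=
    mul_le_mul (hb.norm_tanDeriv_vp_le ht s) (hb.abs_H_le ht s) (abs_nonneg _) hb.pos.le
  rw [heq]
  refine (abs_add_le _ _).trans ?_
  rw [Real.norm_eq_abs] at h1 h2
  linarith

theorem z_periodic (t : ℝ) : Function.Periodic (F.z t) 1 := fun s => by
  simp only [z, hF.θ_periodic s]

theorem δv_periodic (t : ℝ) : Function.Periodic (F.δv t) 1 := fun s => by
  simp only [δv, vp, vm, hF.z_periodic t s]

theorem τ_periodic (t : ℝ) : Function.Periodic (F.τ t) 1 :=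
  tanDeriv_periodic (hF.z_periodic t) (hF.z_periodic t)

theorem slip_periodic (t : ℝ) : Function.Periodic (F.slip t) 1 := fun s => by
  simp only [slip, hF.δv_periodic t s, hF.τ_periodic t s]

theorem stretchJump_periodic (t : ℝ) : Function.Periodic (F.stretchJump t) 1 := fun s => by
  simp only [stretchJump, hF.τ_periodic t s,
    tanDeriv_periodic (hF.z_periodic t) (hF.δv_periodic t) s]

/-- The tangential velocity jump stays bounded up to time `T`. -/
theorem exists_abs_slip_le (hT : 0 < T) (hb : F.Bounds T M) :
    ∃ C, ∀ t ∈ Ico 0 T, ∀ s, |F.slip t s| ≤ C := by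
  have h0 : (0 : ℝ) ∈ Ico 0 T := ⟨le_rfl, hT⟩
  obtain ⟨C₀, hC₀⟩ := (hF.slip_periodic 0).exists_norm_le
    (hF.continuousOn_slip.continuous_slice h0)
  have hM := hb.pos
  refine ⟨(C₀ ^ 2 + 1) * Real.exp (3 * M * T), fun t ht s => ?_⟩
  -- Grönwall: `(w²)' = -2w∇_T H - 2aw² ≤ M(w² + 1) + 2Mw²`, whence the rate `3M`.
  have hanti : AntitoneOn (fun r => (F.slip r s ^ 2 + 1) * Real.exp (-(3 * M * r))) (Icc 0 t) := by
    have hd : ∀ r ∈ Ioo 0 t, HasDerivAt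
        (fun r => (F.slip r s ^ 2 + 1) * Real.exp (-(3 * M * r)))
        ((2 * F.slip r s * (-tanDeriv (F.z r) (F.H r) s - F.slip r s * F.stretchP r s)
          - 3 * M * (F.slip r s ^ 2 + 1)) * Real.exp (-(3 * M * r))) r := fun r hr => by
      have h1 := ((hF.hasDerivAt_slip_time ⟨hr.1, hr.2.trans ht.2⟩ s).fun_pow 2).add_const 1
      have h2 := ((hasDerivAt_id r).const_mul (3 * M)).fun_neg.exp
      refine (h1.fun_mul h2).congr_deriv ?_
      simp only [id]
      push_cast
      ring
    refine antitoneOn_of_deriv_nonpos (convex_Icc 0 t) ?_ ?_ ?_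
    · have hc : ContinuousOn (fun r => F.slip r s) (Icc 0 t) :=
        (hF.continuousOn_slip.continuousOn_slice s).mono fun r hr => ⟨hr.1, hr.2.trans_lt ht.2⟩
      fun_prop
    · rw [interior_Icc]
      exact fun r hr => (hd r hr).differentiableAt.differentiableWithinAt
    · rw [interior_Icc]
      intro r hr
      have hr' : r ∈ Ico 0 T := ⟨hr.1.le, hr.2.trans ht.2⟩
      rw [(hd r hr).deriv]
      refine mul_nonpos_of_nonpos_of_nonneg ?_ (Real.exp_pos _).le
      have h1 := abs_le.1 (hb.abs_tanDeriv_H_le hr' s)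
      have h2 := abs_le.1 (hF.abs_stretchP_le hb hr' s)
      set w := F.slip r s
      set b := tanDeriv (F.z r) (F.H r) s
      set a := F.stretchP r s
      have h3 : -(2 * w * b) ≤ M * (w ^ 2 + 1) := by
        nlinarith [mul_nonneg (by linarith [h1.1] : 0 ≤ M + b) (sq_nonneg (w + 1)),
          mul_nonneg (by linarith [h1.2] : 0 ≤ M - b) (sq_nonneg (w - 1))]
      nlinarith [mul_nonneg (by linarith [h2.1] : 0 ≤ M + a) (sq_nonneg w)]
  have h1 := hanti (left_mem_Icc.2 ht.1) (right_mem_Icc.2 ht.1) ht.1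
  simp only [mul_zero, neg_zero, Real.exp_zero, mul_one] at h1
  rw [Real.exp_neg, ← div_eq_mul_inv, div_le_iff₀ (Real.exp_pos _)] at h1
  have h2 : F.slip 0 s ^ 2 ≤ C₀ ^ 2 := sq_le_sq' (abs_le.1 (hC₀ s)).1 (abs_le.1 (hC₀ s)).2
  have h3 : |F.slip t s| ≤ F.slip t s ^ 2 + 1 := by
    rw [← sq_abs]; nlinarith [sq_nonneg (|F.slip t s| - 1), abs_nonneg (F.slip t s)]
  refine h3.trans (h1.trans ?_)
  have h4 : Real.exp (3 * M * t) ≤ Real.exp (3 * M * T) :=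
    Real.exp_le_exp.2 (mul_le_mul_of_nonneg_left ht.2.le (by positivity))
  exact mul_le_mul (by linarith) h4 (Real.exp_pos _).le (by positivity)

theorem c6_lt_top (hT : 0 < T) (hb : F.Bounds T M) : F.c6 T < ⊤ := by
  obtain ⟨C, hC⟩ := hF.exists_abs_slip_le hT hb
  refine lt_of_le_of_lt (iSup₂_le (a := ENNReal.ofReal (2 * M + (C * (M + M * M) + M)))
    fun t ht => ?_) ENNReal.ofReal_lt_top
  rw [eLpNorm_exponent_top]
  refine eLpNormEssSup_le_of_ae_bound ?_
  filter_upwards [hF.ae_abs_tanDeriv_stretchP_le hb ht, hb.ae_abs_tanDeriv_tanDeriv_H_le ht]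
    with s h1 h2
  rw [Real.norm_of_nonneg (by positivity)]
  refine add_le_add ?_ ((abs_add_le _ _).trans (add_le_add ?_ h2))
  · rw [coeffA, abs_mul, abs_two]
    exact mul_le_mul_of_nonneg_left (hF.abs_stretchP_le hb ht s) zero_le_two
  · rw [abs_mul]
    exact mul_le_mul (hC t ht s) h1 (abs_nonneg _) ((abs_nonneg _).trans (hC t ht s))

omit hF in
theorem ae_coeff_le (hc : F.c6 T < ⊤) {t : ℝ} (ht : t ∈ Ico 0 T) :
    ∀ᵐ s, |F.coeffA t s| + |F.forcing t s| ≤ (F.c6 T).toReal := by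
  have h := le_iSup₂ (f := fun t (_ : t ∈ Ico 0 T) =>
    eLpNorm (fun s => |F.coeffA t s| + |F.forcing t s|) ∞ volume) t ht
  filter_upwards [ae_norm_le_of_eLpNorm_top_le ENNReal.toReal_nonneg
    (h.trans_eq (ENNReal.ofReal_toReal hc.ne).symm)] with s hs
  exact (le_abs_self _).trans hs

/-- Unlike 𝒜, the coefficient 𝔄 is continuous, so its essential bound holds at every point. -/
theorem two_mul_abs_stretchP_le (hc : F.c6 T < ⊤) {t : ℝ} (ht : t ∈ Ico 0 T) (s : ℝ) :
    2 * |F.stretchP t s| ≤ (F.c6 T).toReal := by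
  have hcont : Continuous fun s => 2 * |F.stretchP t s| :=
    (hF.continuousOn_stretchP.continuous_slice ht).abs.const_mul 2
  have hcl : IsClosed {s | 2 * |F.stretchP t s| ≤ (F.c6 T).toReal} :=
    isClosed_le hcont continuous_const
  have hae : ∀ᵐ s, 2 * |F.stretchP t s| ≤ (F.c6 T).toReal := by
    filter_upwards [ae_coeff_le hc ht] with s hs
    rw [coeffA, abs_mul, abs_two] at hs
    linarith [abs_nonneg (F.forcing t s)]
  have := (Measure.dense_of_ae hae).closure_eq
  rw [hcl.closure_eq] at this
  exact eq_univ_iff_forall.1 this s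

/-! ### Riccati comparison for ∇_T δu·T. -/

/-- Increments along the interface of the right-hand side of the equation for `δu · T`. -/
theorem mul_sub_le_slip_rate_sub (hb : F.Bounds T M) (hc : F.c6 T < ⊤) {t : ℝ}
    (ht : t ∈ Ico 0 T) {x y κ : ℝ} (hxy : x ≤ y)
    (hκ : ∀ σ ∈ Icc x y, κ ≤ F.speed t σ *
      (2 * |F.stretchP t σ| - (F.c6 T).toReal - F.stretchP t σ * F.stretchJump t σ)) :
    κ * (y - x) ≤ (-tanDeriv (F.z t) (F.H t) y - F.slip t y * F.stretchP t y)
      - (-tanDeriv (F.z t) (F.H t) x - F.slip t x * F.stretchP t x) := by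
  obtain ⟨K, hK⟩ : ∃ K, LipschitzWith K (tanDeriv (F.z t) (F.H t)) :=
    (hb.1 t ht).2 1 (by norm_num)
  obtain ⟨K', hK'⟩ := hF.exists_lipschitzWith_stretchP hb ht
  have hslip : ContDiff ℝ 1 (F.slip t) := by
    rw [contDiff_one_iff_deriv]
    refine ⟨fun s => (hF.hasDerivAt_slip ht s).differentiableAt, ?_⟩
    rw [show deriv (F.slip t) = fun s => F.speed t s * F.stretchJump t s from
      funext fun s => (hF.hasDerivAt_slip ht s).deriv]
    exact (hF.continuousOn_speed.continuous_slice ht).mul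
      (hF.continuousOn_stretchJump.continuous_slice ht)
  have hac : AbsolutelyContinuousOnInterval
      (fun s => -tanDeriv (F.z t) (F.H t) s - F.slip t s * F.stretchP t s) x y :=
    hK.lipschitzOnWith.absolutelyContinuousOnInterval.neg.sub
      (hslip.contDiffOn.absolutelyContinuousOnInterval.mul
        hK'.lipschitzOnWith.absolutelyContinuousOnInterval)
  refine hac.mul_sub_le_of_le_deriv hxy ?_
  filter_upwards [hK.ae_differentiableAt_real, hK'.ae_differentiableAt_real, ae_coeff_le hc ht]
    with s h1 h2 h3 hs
  have hpos : 0 < F.speed t s := hF.speed_pos ht s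
  have hd := (h1.hasDerivAt.fun_neg.fun_sub ((hF.hasDerivAt_slip ht s).fun_mul h2.hasDerivAt)).deriv
  rw [hd, deriv_eq_speed_smul (tanDeriv (F.z t) (F.H t)) hpos,
    deriv_eq_speed_smul (F.stretchP t) hpos, smul_eq_mul, smul_eq_mul]
  refine (hκ s hs).trans ?_
  rw [coeffA, abs_mul, abs_two] at h3
  have h4 : F.forcing t s ≤ (F.c6 T).toReal - 2 * |F.stretchP t s| := by
    linarith [le_abs_self (F.forcing t s)]
  have h5 := mul_le_mul_of_nonneg_left h4 hpos.le
  have h6 : F.forcing t s = F.slip t s * tanDeriv (F.z t) (F.stretchP t) s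
    + tanDeriv (F.z t) (tanDeriv (F.z t) (F.H t)) s := rfl
  rw [h6] at h5
  linarith

/-- Lower bound for the time slopes of `∂ₛ (δu · T)`. -/
theorem eventually_mul_sub_le (hb : F.Bounds T M) (hc : F.c6 T < ⊤) {t : ℝ} (ht : t ∈ Ioo 0 T)
    (s : ℝ) {κ : ℝ} (hκ : κ < F.speed t s *
      (2 * |F.stretchP t s| - (F.c6 T).toReal - F.stretchP t s * F.stretchJump t s)) :
    ∀ᶠ r in 𝓝[>] t, κ * (r - t) ≤
      F.speed r s * F.stretchJump r s - F.speed t s * F.stretchJump t s := by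
  have hcont : ContinuousAt (fun q : ℝ × ℝ => F.speed q.1 q.2 * (2 * |F.stretchP q.1 q.2|
      - (F.c6 T).toReal - F.stretchP q.1 q.2 * F.stretchJump q.1 q.2)) (t, s) :=
    ContinuousOn.continuousAt_Ioo_prod
      (hF.continuousOn_speed.mul (((hF.continuousOn_stretchP.abs.const_mul 2).sub
        continuousOn_const).sub (hF.continuousOn_stretchP.mul hF.continuousOn_stretchJump))) ht s
  -- The strict inequality at `(t, s)` persists on a space-time square, where it can be integrated
  -- in s and then in time.
  obtain ⟨δ, hδ, hball⟩ := Metric.eventually_nhds_iff.1 (hcont.eventually (lt_mem_nhds hκ))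
  filter_upwards [Ioo_mem_nhdsGT (lt_min (lt_add_of_pos_right t hδ) ht.2)] with r hr
  have hsub : ∀ ρ ∈ Icc t r, ρ ∈ Ioo 0 T := fun ρ hρ =>
    ⟨ht.1.trans_le hρ.1, (hρ.2.trans_lt hr.2).trans_le (min_le_right _ _)⟩
  refine mul_sub_le_partial_sub (f := F.slip) (g := fun t s =>
      -tanDeriv (F.z t) (F.H t) s - F.slip t s * F.stretchP t s)
    (p := fun r => F.speed r s * F.stretchJump r s) hδ hr.1.le
    (fun ρ hρ σ => hF.hasDerivAt_slip_time (hsub ρ hρ) σ) ?_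
    (fun ρ hρ => hF.hasDerivAt_slip (Ioo_subset_Ico_self (hsub ρ hρ)) s)
  intro ρ hρ h hh
  have := hF.mul_sub_le_slip_rate_sub hb hc (Ioo_subset_Ico_self (hsub ρ hρ)) (κ := κ)
    (le_add_of_nonneg_right hh.1.le : s ≤ s + h) fun σ hσ => by
      refine (hball (y := (ρ, σ)) ?_).le
      rw [Prod.dist_eq]
      refine max_lt ?_ ?_
      · rw [Real.dist_eq, abs_of_nonneg (by linarith [hρ.1])]
        linarith [hρ.2, hr.2, min_le_left (t + δ) T]
      · rw [Real.dist_eq, abs_of_nonneg (by linarith [hσ.1])]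
        linarith [hσ.2, hh.2]
  simpa using this

/-- Comparison of `∇_T δu · T` with strict subsolutions of the Riccati equation. -/
theorem le_stretchJump_of_barrier (hb : F.Bounds T M) (hc : F.c6 T < ⊤) {t₀ t₁ : ℝ}
    (ht₀ : 0 < t₀) (ht₁ : t₁ < T) (s : ℝ) {y y' : ℝ → ℝ}
    (hy : ∀ t ∈ Icc t₀ t₁, HasDerivAt y (y' t) t)
    (hy' : ∀ t ∈ Icc t₀ t₁, y' t < y t ^ 2 - (F.c6 T).toReal * |y t|)
    (hone : ∀ t ∈ Icc t₀ t₁, 1 ≤ |y t|) (hinit : y t₀ ≤ F.stretchJump t₀ s)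
    {t : ℝ} (ht : t ∈ Icc t₀ t₁) : y t ≤ F.stretchJump t s := by
  have hsub : ∀ r ∈ Icc t₀ t₁, r ∈ Ioo 0 T := fun r hr =>
    ⟨ht₀.trans_le hr.1, hr.2.trans_lt ht₁⟩
  refine riccati_barrier (ℓ := fun t => F.speed t s) (a := fun t => F.stretchP t s)
    (X := fun t => F.stretchJump t s) (c := (F.c6 T).toReal) ?_ ?_ ?_ ?_ ?_ hy hy' hone hinit ht
  · exact (hF.continuousOn_stretchJump.continuousOn_slice s).mono
      fun r hr => Ioo_subset_Ico_self (hsub r hr)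
  · intro r hr
    refine (hF.hasDerivAt_speed_time (hsub r hr) s).congr_deriv ?_
    rw [hF.stretchJump_eq (Ioo_subset_Ico_self (hsub r hr)), sub_sub_cancel]
  · exact fun r hr => hF.speed_pos (Ioo_subset_Ico_self (hsub r hr)) s
  · exact fun r hr => hF.two_mul_abs_stretchP_le hc (Ioo_subset_Ico_self (hsub r hr)) s
  · exact fun r hr κ hκ =>
      hF.eventually_mul_sub_le hb hc (hsub r (Ico_subset_Icc_self hr)) s hκ

theorem exists_neg_le_stretchJump (hT : 0 < T) (hb : F.Bounds T M) (hc : F.c6 T < ⊤) :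
    ∃ C, 0 < C ∧ ∀ t ∈ Ioo 0 T, ∀ s, -C ≤ F.stretchJump t s := by
  have h0 : (0 : ℝ) ∈ Ico 0 T := ⟨le_rfl, hT⟩
  obtain ⟨C₀, hC₀⟩ := (hF.stretchJump_periodic 0).exists_norm_le
    (hF.continuousOn_stretchJump.continuous_slice h0)
  have hC₀' : 0 ≤ C₀ := (norm_nonneg _).trans (hC₀ 0)
  have hc0 : 0 ≤ (F.c6 T).toReal := ENNReal.toReal_nonneg
  -- `C > c₆` makes the constant `-C` a strict subsolution, `C ≥ 1` meets the barrier's requirement,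
  -- and `C > C₀` puts it strictly below the initial data.
  set C := C₀ + (F.c6 T).toReal + 1 with hC
  have hCpos : 1 ≤ C := by linarith
  refine ⟨C, by linarith, fun t ht s => ?_⟩
  have hcont := hF.continuousOn_stretchJump.continuousOn_slice s 0 h0
  have hinit : -C < F.stretchJump 0 s := by linarith [(abs_le.1 (hC₀ s)).1]
  have hev : ∀ᶠ r in 𝓝[>] (0 : ℝ), -C < F.stretchJump r s :=
    (nhdsWithin_le_of_mem (mem_of_superset (Ioo_mem_nhdsGT hT) Ioo_subset_Ico_self))
      (hcont.eventually (lt_mem_nhds hinit))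
  -- The evolution equations hold only for positive times, so the comparison starts slightly after
  -- 0.
  obtain ⟨t₁, ht₁, ht₁'⟩ := (hev.and (Ioo_mem_nhdsGT ht.1)).exists
  refine hF.le_stretchJump_of_barrier hb hc ht₁'.1 ht.2 s (y := fun _ => -C) (y' := fun _ => 0)
    (fun r _ => hasDerivAt_const r (-C)) (fun r _ => ?_) (fun r _ => ?_) ht₁.le
    (right_mem_Icc.2 ht₁'.2.le)
  · rw [abs_neg, abs_of_nonneg (by linarith)]
    nlinarith
  · rwa [abs_neg, abs_of_nonneg (by linarith)]

theorem stretchJump_le (hb : F.Bounds T M) (hc : F.c6 T < ⊤) {t : ℝ} (ht : t ∈ Ioo 0 T) (s : ℝ) :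
    F.stretchJump t s ≤ 1 / (T - t) + ((F.c6 T).toReal + 1) := by
  have hc0 : 0 ≤ (F.c6 T).toReal := ENNReal.toReal_nonneg
  set c := (F.c6 T).toReal with hcdef
  by_contra! hlt
  have hTt : 0 < T - t := sub_pos.2 ht.2
  have hcontS : ContinuousAt (fun S => 1 / (S - t) + (c + 1)) T := by
    fun_prop (disch := exact hTt.ne')
  -- By strictness the blow-up time of the barrier can be moved from `T` to some `S < T`, up to
  -- which the stretching jump stays bounded.
  obtain ⟨S, hS, hS'⟩ := (((hcontS.eventually (gt_mem_nhds hlt)).filter_mono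
    nhdsWithin_le_nhds).and (Ioo_mem_nhdsLT ht.2)).exists
  have hX : ContinuousOn (fun r => F.stretchJump r s) (Icc t S) :=
    (hF.continuousOn_stretchJump.continuousOn_slice s).mono
      fun r hr => ⟨ht.1.le.trans hr.1, hr.2.trans_lt hS'.2⟩
  obtain ⟨B, hB⟩ := isCompact_Icc.exists_bound_of_continuousOn hX
  have hB0 : 0 ≤ B := (norm_nonneg _).trans (hB t (left_mem_Icc.2 hS'.1.le))
  have key : ∀ r ∈ Ico t S, 1 / (S - r) + (c + 1) ≤ F.stretchJump r s := by
    intro r hr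
    have hpos : ∀ x ∈ Icc t r, 0 < 1 / (S - x) := fun x hx =>
      one_div_pos.2 (by linarith [hx.2, hr.2])
    refine hF.le_stretchJump_of_barrier hb hc ht.1 (hr.2.trans hS'.2) s
      (y := fun x => 1 / (S - x) + (c + 1)) (y' := fun x => (1 / (S - x)) ^ 2)
      (fun x hx => ?_) (fun x hx => ?_) (fun x hx => ?_) hS.le (right_mem_Icc.2 hr.1)
    · have hne : S - x ≠ 0 := (sub_pos.2 (hx.2.trans_lt hr.2)).ne'
      have := (((hasDerivAt_id x).const_sub S).inv hne).add_const (c + 1)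
      simp only [id] at this
      refine (this.congr_deriv (by field_simp)).congr_of_eventuallyEq
        (Eventually.of_forall fun x => by simp [one_div])
    · have := hpos x hx
      rw [abs_of_nonneg (by linarith)]
      -- With q = 1/(S - x): y² - c y = (q + c + 1)(q + 1) > q² = y'.
      nlinarith
    · have := hpos x hx
      rw [abs_of_nonneg (by linarith)]
      linarith
  have hSt : 0 < S - t := sub_pos.2 hS'.1
  -- At distance at most `1 / (B + 1)` before `S` the barrier exceeds the bound `B`.
  have hd : 0 < min (S - t) (1 / (B + 1)) := lt_min hSt (by positivity)
  set d := min (S - t) (1 / (B + 1)) with hd'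
  have hmem : S - d ∈ Ico t S := ⟨by linarith [min_le_left (S - t) (1 / (B + 1))], by linarith⟩
  have h1 := key _ hmem
  have h2 := (le_abs_self _).trans (hB _ (Ico_subset_Icc_self hmem))
  have h3 : B + 1 ≤ 1 / d := by
    rw [le_one_div (by positivity) hd]
    exact min_le_right _ _
  rw [sub_sub_cancel] at h1
  linarith

/-- From `stretchM = stretchP - stretchJump`: once `1 / (T - t)` dominates `C`, both signs are
covered, with c₆ + c₆/2 ≤ 2c₆ to spare. -/
theorem abs_stretchM_le (hb : F.Bounds T M) (hc : F.c6 T < ⊤) {C : ℝ}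
    (hC : ∀ t ∈ Ioo 0 T, ∀ s, -C ≤ F.stretchJump t s) {t : ℝ} (ht : t ∈ Ioo 0 T)
    (hCt : C ≤ 1 / (T - t)) (s : ℝ) :
    |F.stretchM t s| ≤ (1 + (1 + 2 * (F.c6 T).toReal) * (T - t)) / (T - t) := by
  have ht' := Ioo_subset_Ico_self ht
  have hTt : 0 < T - t := sub_pos.2 ht.2
  have hc0 : 0 ≤ (F.c6 T).toReal := ENNReal.toReal_nonneg
  have h1 := hF.stretchJump_le hb hc ht s
  have h2 := hC t ht s
  have h3 := hF.two_mul_abs_stretchP_le hc ht' s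
  have h4 := hF.stretchJump_eq ht' s
  have h5 := abs_le.1 (le_refl |F.stretchP t s|)
  rw [add_div, mul_div_cancel_right₀ _ hTt.ne', abs_le]
  constructor <;> linarith

end IsSolution

end Flow

end VortexSheet

/-! ### The stretching bound for `u⁻`. -/

theorem corollary1 (F : VortexSheet.Flow) (T g M : ℝ) (hT : 0 < T)
    (hF : F.IsSolution T g) (hbounds : F.Bounds T M) (hblow : F.BlowUp T) :
    F.c6 T < ⊤ ∧
      ∀ ε : ℝ, 0 < ε → ε ≤ T → ∃ t₀ ∈ Set.Ico (T - ε) T, ∀ t ∈ Set.Ico t₀ T,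
        MeasureTheory.eLpNorm (F.stretchM t) ⊤ MeasureTheory.volume ≤
          ENNReal.ofReal ((1 + (1 + 2 * (F.c6 T).toReal) * (T - t)) / (T - t)) := by
  have hc := hF.c6_lt_top hT hbounds
  refine ⟨hc, fun ε hε _ => ?_⟩
  obtain ⟨C, hCpos, hC⟩ := hF.exists_neg_le_stretchJump hT hbounds hc
  -- `T / 2` keeps t positive, and `T - 1 / C` ensures `C ≤ 1 / (T - t)`.
  refine ⟨max (T - ε) (max (T / 2) (T - 1 / C)), ⟨le_max_left _ _, ?_⟩, fun t ht => ?_⟩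
  · have : 0 < 1 / C := by positivity
    exact max_lt (by linarith) (max_lt (by linarith) (by linarith))
  · have h1 : T / 2 ≤ t := (le_max_left _ _).trans ((le_max_right _ _).trans ht.1)
    have h2 : T - 1 / C ≤ t := (le_max_right _ _).trans ((le_max_right _ _).trans ht.1)
    rw [eLpNorm_exponent_top]
    refine eLpNormEssSup_le_of_ae_bound (Eventually.of_forall fun s => ?_)
    refine hF.abs_stretchM_le hbounds hc hC ⟨by linarith, ht.2⟩ ?_ s
    rw [le_one_div hCpos (sub_pos.2 ht.2)]
    linarith
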